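/- Let $p>3$ be a prime, $R$ the ring of integers of a finite extension of $\mathbb{Q}_p$ that contains a primitive $p$-th root of unity $\varepsilon$, $F\supseteq R$ a field, and $G=\langle a\mid a^p=1\rangle$. For an $RG$-module $M$ that is free of finite rank over $R$ put $FM=F\otimes_R M$ and $\widehat M=FM/M$. For a 1-cocycle $\mathfrak f:G\to\widehat M$, i.e. $\mathfrak f(xy)=x\mathfrak f(y)+\mathfrak f(x)$, let $$\mathrm{Crys}(G,M,\mathfrak f)=\Big\{[g,x]=\begin{pmatrix}g&x\\0&1\end{pmatrix}\ \Big|\ g\in G,\ x\in\mathfrak f(g)\Big\}.$$ This group is non-split if $\mathfrak f$ is not a coboundary, and it is non-split indecomposable if moreover $M$ is an indecomposable $RG$-module. $\mathrm{Crys}(G,M,\mathfrak f)$ and $\mathrm{Crys}(G,M',\mathfrak f')$ are equivalent if there is a group isomorphism between them over the identity of $G$ whose restriction to translations is an $R$-linear isomorphism $M\to M'$. (1) The classification of the non-split indecomposable groups $\mathrm{Crys}(G,M,\mathfrak f)$ up to equivalence is a wild problem, i.e. it contains the classification of pairs of matrices over a field up to simultaneous similarity, in the following sense. There are a maximal ideal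 $\mathfrak m$ of $R$, an $N\ge 0$ and an $N\times N$ matrix $W$ over the free algebra $R\langle x,y\rangle$ with $W^p=1$ such that, if $M_{A,B}=R^{Nm}$ denotes the $RG$-module on which $a$ acts as $W(A,B)$, for $A,B\in M_m(R)$: if the pair $(A,B)$ is indecomposable over $R/\mathfrak m$, then $M_{A,B}$ is indecomposable and there is a non-split group $\mathrm{Crys}(G,M_{A,B},\mathfrak f)$; if some $\mathrm{Crys}(G,M_{A,B},\mathfrak f)$ and $\mathrm{Crys}(G,M_{A_1,B_1},\mathfrak f_1)$, with $A,B,A_1,B_1\in M_m(R)$, are equivalent, then $(A,B)$ and $(A_1,B_1)$ are simultaneously similar over $R/\mathfrak m$; and if these pairs are simultaneously similar over $R/\mathfrak m$, then every $\mathrm{Crys}(G,M_{A,B},\mathfrak f)$ is equivalent to some $\mathrm{Crys}(G,M_{A_1,B_1},\mathfrak f_1)$. (2) For all $m\geq 0$ and all $A,B\in M_m(R)$ the assignment $$\Gamma_{A,B}:\ a\mapsto\begin{pmatrix}E&0&E&A&E\\0&\varepsilon E&E&E&B\\0&0&\varepsilon^2E&0&0\\0&0&0&\varepsilon^3E&0\\0&0&0&0&\varepsilon^4E\end{pmatrix}$$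 is an $R$-representation of $G$ on $R^{5m}$, and: (a) $\Gamma_{A,B}$ and $\Gamma_{A_1,B_1}$ are $R$-equivalent if and only if there is $C\in GL_m(R)$ with $C^{-1}AC\equiv A_1$ and $C^{-1}BC\equiv B_1\pmod{1-\varepsilon}$. (b) $\Gamma_{A,B}$ is indecomposable if and only if the pair $(A,B)$ is indecomposable over $R/(1-\varepsilon)R$. (c) For every $X\in F^m$ with $pX\in R^m$ there is exactly one 1-cocycle $\mathfrak f_X:G\to\widehat{R^{5m}}$ with $\mathfrak f_X(a)=(X,0,0,0,0)+R^{5m}$; cocycles $\mathfrak f_X$, $\mathfrak f_Y$ of this form are cohomologous if and only if $(1-\varepsilon)(X-Y)\in R^m$. (d) If $X=p^{-1}e_j$ for a standard basis vector $e_j$ of $F^m$, then $\mathfrak f_X$ is not a coboundary; so $H^1(G,\widehat{R^{5m}})\ne0$ whenever $m\ge1$. (e) For $m\ge1$ there are equivalent non-split groups $\mathrm{Crys}(G,R^{5m},\mathfrak f)$ and $\mathrm{Crys}(G,R^{5m},\mathfrak f_1)$, where $G$ acts by $\Gamma_{A,B}$ and by $\Gamma_{A_1,B_1}$ respectively, if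 and only if $(A,B)$ and $(A_1,B_1)$ are related as in (a). -/

import Mathlib

open scoped TensorProduct

noncomputable section

/-! Decompositions of representations, and pairs of matrices. -/

/-- An `R`-representation of `G` on `M` is indecomposable: `M ≠ 0`, and `M` is not the direct sum
of two nonzero `G`-invariant `R`-submodules. -/
def RepIndecomposable {R G M : Type*} [CommRing R] [Group G] [AddCommGroup M] [Module R M]
    (ρ : Representation R G M) : Prop :=
  Nontrivial M ∧ ∀ U W : Submodule R M, (∀ g, U ≤ U.comap (ρ g)) → (∀ g, W ≤ W.comap (ρ g)) →
    IsCompl U W → U = ⊥ ∨ W = ⊥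

/-- Two pairs of `m × m` matrices over `S` are simultaneously similar. -/
def PairSimilar {S : Type*} [CommRing S] {m : ℕ} (A B A₁ B₁ : Matrix (Fin m) (Fin m) S) : Prop :=
  ∃ C : GL (Fin m) S, (C⁻¹).val * A * C.val = A₁ ∧ (C⁻¹).val * B * C.val = B₁

/-- `C⁻¹ A C ≡ A₁` and `C⁻¹ B C ≡ B₁` modulo the ideal `I`, for some invertible matrix `C`
over `S`. -/
def PairSimilarMod {S : Type*} [CommRing S] (I : Ideal S) {m : ℕ}
    (A B A₁ B₁ : Matrix (Fin m) (Fin m) S) : Prop :=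
  ∃ C : GL (Fin m) S, (∀ i j, ((C⁻¹).val * A * C.val) i j - A₁ i j ∈ I) ∧
    (∀ i j, ((C⁻¹).val * B * C.val) i j - B₁ i j ∈ I)

/-- A pair of matrices is indecomposable: the module `S ^ m` is nonzero and is not the direct sum
of two nonzero submodules that are invariant under both matrices. -/
def PairIndecomposable {S : Type*} [CommRing S] {m : ℕ} (A B : Matrix (Fin m) (Fin m) S) : Prop :=
  Nontrivial (Fin m → S) ∧ ∀ U W : Submodule S (Fin m → S),
    (∀ u ∈ U, A.mulVec u ∈ U ∧ B.mulVec u ∈ U) → (∀ w ∈ W, A.mulVec w ∈ W ∧ B.mulVec w ∈ W) →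
    IsCompl U W → U = ⊥ ∨ W = ⊥

/-- The reduction of a matrix modulo an ideal. -/
def matMod {S : Type*} [CommRing S] (I : Ideal S) {m : ℕ} (A : Matrix (Fin m) (Fin m) S) :
    Matrix (Fin m) (Fin m) (S ⧸ I) :=
  A.map (Ideal.Quotient.mk I)

/-! The first cohomology group. -/

section Cohomology

variable {R G V : Type*} [CommRing R] [Group G] [AddCommGroup V] [Module R V]

/-- The `1`-cocycles `f (x y) = x f(y) + f(x)`. -/
def oneCocycles (σ : Representation R G V) : Submodule R (G → V) where
  carrier := {f | ∀ x y, f (x * y) = σ x (f y) + f x}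
  add_mem' {f g} hf hg x y := by
    simp only [Set.mem_ofPred_eq] at hf hg
    simp only [Pi.add_apply, hf, hg, map_add]
    abel
  zero_mem' x y := by simp
  smul_mem' c f hf x y := by
    simp only [Set.mem_ofPred_eq] at hf
    simp [hf]

/-- The `1`-coboundaries `g ↦ (g - 1) v`, as a submodule of the `1`-cocycles. -/
def oneCoboundaries (σ : Representation R G V) : Submodule R (oneCocycles σ) where
  carrier := {f | ∃ v : V, ∀ g, f.1 g = σ g v - v}
  add_mem' {f g} hf hg := by
    obtain ⟨v, hv⟩ := hf
    obtain ⟨w, hw⟩ := hg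
    refine ⟨v + w, fun x => ?_⟩
    simp only [Submodule.coe_add, Pi.add_apply, hv, hw, map_add]
    abel
  zero_mem' := ⟨0, fun g => by simp⟩
  smul_mem' c f hf := by
    obtain ⟨v, hv⟩ := hf
    exact ⟨c • v, fun g => by simp [hv, smul_sub]⟩

/-- The first cohomology group. -/
abbrev firstCohomology (σ : Representation R G V) : Type _ :=
  oneCocycles σ ⧸ oneCoboundaries σ

/-- The action of `G` on the additive group of `V`, by automorphisms. -/
def autAction (σ : Representation R G V) : G →* MulAut (Multiplicative V) where
  toFun g := AddEquiv.toMultiplicative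
    { toFun := σ g
      invFun := σ g⁻¹
      left_inv := fun v => by simp
      right_inv := fun v => by simp
      map_add' := fun v w => map_add _ v w }
  map_one' := by
    ext v
    change σ 1 (Multiplicative.toAdd v) = _
    simp
  map_mul' x y := by
    ext v
    change σ (x * y) (Multiplicative.toAdd v) = σ x (σ y (Multiplicative.toAdd v))
    simp

end Cohomology

/-! The groups `Crys(G, M, f)`. -/

section Crys

variable {R G M : Type*} [CommRing R] [Group G] [AddCommGroup M] [Module R M]
variable (F : Type*) [Field F] [Algebra R F] (ρ : Representation R G M)

/-- The image of `M` in `F M = F ⊗ M`. -/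
def lattice (R : Type*) (M : Type*) [CommRing R] [AddCommGroup M] [Module R M]
    (F : Type*) [Field F] [Algebra R F] : Submodule R (F ⊗[R] M) :=
  LinearMap.range (TensorProduct.mk R F M 1)

/-- The action of `G` on `F M = F ⊗ M`. -/
def scalarExt : Representation R G (F ⊗[R] M) :=
  (Representation.trivial R G F).tprod ρ

theorem lattice_le_comap (g : G) :
    lattice R M F ≤ (lattice R M F).comap (scalarExt F ρ g) := by
  rintro _ ⟨m, rfl⟩
  exact ⟨ρ g m, by simp [scalarExt]⟩

/-- The `G`-module `M^ = F M / M`. -/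
def hatRep : Representation R G ((F ⊗[R] M) ⧸ lattice R M F) :=
  (scalarExt F ρ).quotient (lattice R M F) (lattice_le_comap F ρ)

variable {F ρ}

/-- The group of all `[g, x]` with `g ∈ G` and `x` in the coset `f(g)` of `M` in `F M`. The product
`[g, x] [h, y] = [g h, g y + x]` of the matrices `(g x; 0 1)` is that of the semidirect product of
`F M` with `G`. -/
def Crys (f : oneCocycles (hatRep F ρ)) :
    Subgroup (Multiplicative (F ⊗[R] M) ⋊[autAction (scalarExt F ρ)] G) where
  carrier := {z | (lattice R M F).mkQ (Multiplicative.toAdd z.left) = f.1 z.right}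
  one_mem' := by
    have h := f.2 1 1
    simp only [mul_one, map_one, Module.End.one_apply] at h
    have h0 : f.1 1 = 0 := by simpa using h
    simp [h0]
  mul_mem' {a b} ha hb := by
    simp only [Set.mem_ofPred_eq] at ha hb ⊢
    rw [SemidirectProduct.mul_right, f.2, SemidirectProduct.mul_left, toAdd_mul, map_add, ha, ← hb,
      add_comm]
    rfl
  inv_mem' {a} ha := by
    simp only [Set.mem_ofPred_eq] at ha ⊢
    have h1 := f.2 1 1
    simp only [mul_one, map_one, Module.End.one_apply] at h1
    have h0 : f.1 1 = 0 := by simpa using h1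
    have h := f.2 a.right⁻¹ a.right
    rw [inv_mul_cancel, h0, ← ha] at h
    rw [SemidirectProduct.inv_right, eq_neg_of_add_eq_zero_right h.symm,
      SemidirectProduct.inv_left]
    change (lattice R M F).mkQ (scalarExt F ρ a.right⁻¹ (-(Multiplicative.toAdd a.left))) = _
    rw [map_neg, map_neg]
    rfl

/-- The translation `[e, m]` by an element `m` of `M`. -/
def Crys.translation (f : oneCocycles (hatRep F ρ)) (m : M) : Crys f :=
  ⟨⟨Multiplicative.ofAdd ((1 : F) ⊗ₜ[R] m), 1⟩, by
    have h1 := f.2 1 1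
    simp only [mul_one, map_one, Module.End.one_apply] at h1
    have h0 : f.1 1 = 0 := by simpa using h1
    change (lattice R M F).mkQ ((1 : F) ⊗ₜ[R] m) = f.1 1
    rw [h0, Submodule.mkQ_apply, Submodule.Quotient.mk_eq_zero]
    exact ⟨m, rfl⟩⟩

/-- `Crys(G, M, f)` is non-split: the class of `f` in the first cohomology group is not zero. -/
def IsNonsplit (f : oneCocycles (hatRep F ρ)) : Prop :=
  f ∉ oneCoboundaries (hatRep F ρ)

/-- Equivalence of `Crys(G, M, f)` and `Crys(G, M', f')`: an isomorphism of groups over the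
identity of `G` that restricts to an `R`-linear isomorphism of the translation subgroups
`M` and `M'`. -/
def CrysEquivalent {M' : Type*} [AddCommGroup M'] [Module R M'] {ρ' : Representation R G M'}
    (f : oneCocycles (hatRep F ρ)) (f' : oneCocycles (hatRep F ρ')) : Prop :=
  ∃ Φ : Crys f ≃* Crys f', (∀ z, (Φ z).1.right = z.1.right) ∧
    ∃ φ : M ≃ₗ[R] M', ∀ m, Φ (Crys.translation f m) = Crys.translation f' (φ m)

end Crys

/-! Matrix representations of the cyclic group of order `p`, and wildness. -/

section Wild

/-- The representation of the cyclic group of order `p`, generated by `a`, that maps `a` to a given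
matrix `W` with `W ^ p = 1`. -/
def cyclicRep {R : Type*} [CommRing R] {ι : Type*} [Fintype ι] [DecidableEq ι] {p : ℕ} [NeZero p]
    (W : Matrix ι ι R) (h : W ^ p = 1) :
    Representation R (Multiplicative (ZMod p)) (ι → R) where
  toFun g := Matrix.toLin' (W ^ (Multiplicative.toAdd g).val)
  map_one' := by
    rw [toAdd_one, ZMod.val_zero, pow_zero, Matrix.toLin'_one]
    rfl
  map_mul' x y := by
    have hmod : ∀ n : ℕ, W ^ (n % p) = W ^ n := fun n => by
      conv_rhs => rw [← Nat.mod_add_div n p, pow_add, pow_mul, h, one_pow, mul_one]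
    rw [toAdd_mul, ZMod.val_add, hmod, pow_add, Matrix.toLin'_mul]
    rfl

/-- The generator `a` of the cyclic group of order `p`. -/
def cyclicGen (p : ℕ) : Multiplicative (ZMod p) := Multiplicative.ofAdd 1

/-- Substitution of two `m × m` matrices `A`, `B` for the free variables `x`, `y` in an `N × N`
matrix with entries in the free algebra `R⟨x, y⟩`; the result is an `N × N` array of
`m × m` blocks. -/
def substPair {R : Type*} [CommRing R] {N m : ℕ}
    (W : Matrix (Fin N) (Fin N) (FreeAlgebra R (Fin 2))) (A B : Matrix (Fin m) (Fin m) R) :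
    Matrix (Fin N × Fin m) (Fin N × Fin m) R :=
  Matrix.compRingEquiv (Fin N) (Fin m) R
    ((FreeAlgebra.lift R ![A, B] : FreeAlgebra R (Fin 2) →ₐ[R] _).toRingHom.mapMatrix W)

theorem substPair_pow {R : Type*} [CommRing R] {N m p : ℕ}
    {W : Matrix (Fin N) (Fin N) (FreeAlgebra R (Fin 2))} (h : W ^ p = 1)
    (A B : Matrix (Fin m) (Fin m) R) : substPair W A B ^ p = 1 := by
  rw [substPair, ← map_pow, ← map_pow, h, map_one, map_one]

/-- The description of the non-split indecomposable groups `Crys(G, M, f)`, where `G` is cyclic of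
order `p` and `M` runs over the `RG`-modules that are free of finite rank over `R`, is a problem of
wild type: it contains the problem of classifying pairs of matrices over a field up to simultaneous
similarity.

The field is a residue field `R / 𝔪`, and a pair over it is represented by a pair `(A, B)` over
`R`. The embedding is given by one bimodule that is free of some finite rank `N` over `R⟨x, y⟩`,
that is, by a matrix `W` over `R⟨x, y⟩` with `W ^ p = 1`: the module of `(A, B)` is
`R ^ (N m)`, on which `a` acts as `W (A, B)`. It is required that
* for an indecomposable pair the module is indecomposable and carries a non-split group;
* groups on the modules of two pairs can be equivalent only if the pairs are similar over `R / 𝔪`;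
* if two pairs are similar over `R / 𝔪`, the groups on their modules are the same up to
  equivalence.

Only pairs of equal size are compared, as the modules of pairs of different sizes have different
ranks. -/
def IsWildCrysProblem (p : ℕ) [NeZero p] (R F : Type*) [CommRing R] [Field F] [Algebra R F] :
    Prop :=
  ∃ (𝔪 : Ideal R) (_ : 𝔪.IsMaximal) (N : ℕ)
    (W : Matrix (Fin N) (Fin N) (FreeAlgebra R (Fin 2))) (hW : W ^ p = 1),
    (∀ (m : ℕ) (A B : Matrix (Fin m) (Fin m) R),
      PairIndecomposable (matMod 𝔪 A) (matMod 𝔪 B) →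
        RepIndecomposable (cyclicRep (substPair W A B) (substPair_pow hW A B)) ∧
        ∃ f : oneCocycles (hatRep F (cyclicRep (substPair W A B) (substPair_pow hW A B))),
          IsNonsplit f) ∧
    (∀ (m : ℕ) (A B A₁ B₁ : Matrix (Fin m) (Fin m) R)
      (f : oneCocycles (hatRep F (cyclicRep (substPair W A B) (substPair_pow hW A B))))
      (f₁ : oneCocycles (hatRep F (cyclicRep (substPair W A₁ B₁) (substPair_pow hW A₁ B₁)))),
      CrysEquivalent f f₁ →
        PairSimilar (matMod 𝔪 A) (matMod 𝔪 B) (matMod 𝔪 A₁) (matMod 𝔪 B₁)) ∧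
    (∀ (m : ℕ) (A B A₁ B₁ : Matrix (Fin m) (Fin m) R),
      PairSimilar (matMod 𝔪 A) (matMod 𝔪 B) (matMod 𝔪 A₁) (matMod 𝔪 B₁) →
      ∀ f : oneCocycles (hatRep F (cyclicRep (substPair W A B) (substPair_pow hW A B))),
        ∃ f₁ : oneCocycles (hatRep F (cyclicRep (substPair W A₁ B₁) (substPair_pow hW A₁ B₁))),
          CrysEquivalent f f₁)

/-- The matrix `Γ_{A,B}(a)`, with `5 × 5` blocks of size `m × m`. -/
def Gam {R : Type*} [CommRing R] {m : ℕ} (ε : R) (A B : Matrix (Fin m) (Fin m) R) :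
    Matrix (Fin 5 × Fin m) (Fin 5 × Fin m) R :=
  Matrix.comp (Fin 5) (Fin 5) (Fin m) (Fin m) R
    !![1, 0, 1, A, 1;
       0, ε • 1, 1, 1, B;
       0, 0, ε ^ 2 • 1, 0, 0;
       0, 0, 0, ε ^ 3 • 1, 0;
       0, 0, 0, 0, ε ^ 4 • 1]

/-- The class `(X, 0, 0, 0, 0) + R ^ (5 m)` of a vector `X ∈ F ^ m`. -/
def firstBlock (R : Type*) {F : Type*} [CommRing R] [Field F] [Algebra R F] {m : ℕ}
    (X : Fin m → F) :
    (F ⊗[R] (Fin 5 × Fin m → R)) ⧸ lattice R (Fin 5 × Fin m → R) F :=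
  (lattice R (Fin 5 × Fin m → R) F).mkQ
    (∑ j, X j ⊗ₜ[R] (Pi.single ((0 : Fin 5), j) (1 : R)))

end Wild

end

noncomputable section

/-! The integral closure of `ℤ_[p]` in a finite extension of `ℚ_[p]`. -/

theorem isIntegral_padicInt_iff_spectralNorm_le_one (p : ℕ) [Fact p.Prime] {T : Type*} [Field T]
    [Algebra ℚ_[p] T] [FiniteDimensional ℚ_[p] T] [Algebra ℤ_[p] T] [IsScalarTower ℤ_[p] ℚ_[p] T]
    (x : T) :
    IsIntegral ℤ_[p] x ↔ spectralNorm ℚ_[p] T x ≤ 1 := by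
  have hx : IsIntegral ℚ_[p] x := Algebra.IsIntegral.isIntegral x
  rw [spectralNorm, spectralValue_le_one_iff (minpoly.monic hx)]
  constructor
  · intro h n
    rw [minpoly.isIntegrallyClosed_eq_field_fractions' ℚ_[p] h, Polynomial.coeff_map]
    exact PadicInt.norm_le_one _
  · intro h
    have hl : minpoly ℚ_[p] x ∈ Polynomial.lifts (algebraMap ℤ_[p] ℚ_[p]) := by
      rw [Polynomial.lifts_iff_coeff_lifts]
      exact fun n => ⟨⟨_, h n⟩, rfl⟩
    obtain ⟨q, hq, -, hm⟩ := Polynomial.lifts_and_degree_eq_and_monic hl (minpoly.monic hx)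
    refine ⟨q, hm, ?_⟩
    rw [← Polynomial.aeval_def, ← Polynomial.aeval_map_algebraMap ℚ_[p], hq, minpoly.aeval]


theorem IsIntegralClosure.isUnit_padicInt_iff_spectralNorm_eq_one
    (p : ℕ) [Fact p.Prime] (T : Type*) [Field T]
    [Algebra ℚ_[p] T] [FiniteDimensional ℚ_[p] T] [Algebra ℤ_[p] T] [IsScalarTower ℤ_[p] ℚ_[p] T]
    (R : Type*) [CommRing R] [Algebra R T] [IsIntegralClosure R ℤ_[p] T] (r : R) :
    IsUnit r ↔ spectralNorm ℚ_[p] T (algebraMap R T r) = 1 := by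
  have hinj := IsIntegralClosure.algebraMap_injective R ℤ_[p] T
  have hle : ∀ s : R, spectralNorm ℚ_[p] T (algebraMap R T s) ≤ 1 := fun s =>
    (isIntegral_padicInt_iff_spectralNorm_le_one p _).1
      ((IsIntegralClosure.isIntegral_iff (A := R)).2 ⟨s, rfl⟩)
  have h1 : spectralNorm ℚ_[p] T 1 = 1 := spectralNorm_one
  constructor
  · rintro ⟨u, rfl⟩
    have h := spectralAlgNorm_mul (K := ℚ_[p]) (algebraMap R T u) (algebraMap R T (u⁻¹ : Rˣ))
    simp only [spectralAlgNorm_def] at h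
    rw [← map_mul, Units.mul_inv, map_one, h1] at h
    have := hle u
    have := hle (u⁻¹ : Rˣ)
    have := spectralNorm_nonneg (K := ℚ_[p]) (algebraMap R T u)
    nlinarith
  · intro h
    have h0 : algebraMap R T r ≠ 0 := fun h0 => by simp [h0, spectralNorm_zero] at h
    have h2 := spectralAlgNorm_mul (K := ℚ_[p]) (algebraMap R T r) (algebraMap R T r)⁻¹
    simp only [spectralAlgNorm_def] at h2
    rw [mul_inv_cancel₀ h0, h1, h, one_mul] at h2
    obtain ⟨s, hs⟩ := (IsIntegralClosure.isIntegral_iff (A := R)).1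
      ((isIntegral_padicInt_iff_spectralNorm_le_one p _).2 h2.symm.le)
    refine IsUnit.of_mul_eq_one s (hinj ?_)
    rw [map_mul, hs, map_one, mul_inv_cancel₀ h0]

theorem IsIntegralClosure.isDomain_of_padicInt
    (p : ℕ) [Fact p.Prime] (T : Type*) [Field T]
    [Algebra ℚ_[p] T] [FiniteDimensional ℚ_[p] T] [Algebra ℤ_[p] T] [IsScalarTower ℤ_[p] ℚ_[p] T]
    (R : Type*) [CommRing R] [Algebra R T] [IsIntegralClosure R ℤ_[p] T] :
    IsDomain R :=
  (IsIntegralClosure.algebraMap_injective R ℤ_[p] T).isDomain (algebraMap R T)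

theorem IsIntegralClosure.isLocalRing_of_padicInt
    (p : ℕ) [Fact p.Prime] (T : Type*) [Field T]
    [Algebra ℚ_[p] T] [FiniteDimensional ℚ_[p] T] [Algebra ℤ_[p] T] [IsScalarTower ℤ_[p] ℚ_[p] T]
    (R : Type*) [CommRing R] [Algebra R T] [IsIntegralClosure R ℤ_[p] T] :
    IsLocalRing R := by
  have := IsIntegralClosure.isDomain_of_padicInt p T R
  refine IsLocalRing.of_nonunits_add fun a b ha hb => ?_
  simp only [mem_nonunits_iff, IsIntegralClosure.isUnit_padicInt_iff_spectralNorm_eq_one p T] at *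
  have hle : ∀ s : R, spectralNorm ℚ_[p] T (algebraMap R T s) ≤ 1 := fun s =>
    (isIntegral_padicInt_iff_spectralNorm_le_one p _).1
      ((IsIntegralClosure.isIntegral_iff (A := R)).2 ⟨s, rfl⟩)
  rw [map_add]
  refine ne_of_lt ((isNonarchimedean_spectralNorm _ _).trans_lt
    (max_lt ((hle a).lt_of_ne ha) ((hle b).lt_of_ne hb)))

theorem IsIntegralClosure.not_isUnit_natCast_of_padicInt
    (p : ℕ) [Fact p.Prime] (T : Type*) [Field T]
    [Algebra ℚ_[p] T] [FiniteDimensional ℚ_[p] T] [Algebra ℤ_[p] T] [IsScalarTower ℤ_[p] ℚ_[p] T]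
    (R : Type*) [CommRing R] [Algebra R T] [IsIntegralClosure R ℤ_[p] T] :
    ¬ IsUnit (p : R) := by
  rw [IsIntegralClosure.isUnit_padicInt_iff_spectralNorm_eq_one p T, map_natCast,
    ← map_natCast (algebraMap ℚ_[p] T), spectralNorm_extends, Padic.norm_p]
  have : (1 : ℝ) < p := by exact_mod_cast (Fact.out : p.Prime).one_lt
  exact (inv_lt_one_of_one_lt₀ this).ne

theorem IsIntegralClosure.charZero_of_padicInt
    (p : ℕ) [Fact p.Prime] (T : Type*) [Field T]
    [Algebra ℚ_[p] T] [FiniteDimensional ℚ_[p] T] [Algebra ℤ_[p] T] [IsScalarTower ℤ_[p] ℚ_[p] T]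
    (R : Type*) [CommRing R] [Algebra R T] [IsIntegralClosure R ℤ_[p] T] :
    CharZero R := by
  have : CharZero T := charZero_of_injective_algebraMap (algebraMap ℚ_[p] T).injective
  exact ⟨fun a b h => Nat.cast_injective (R := T) (by simpa using congrArg (algebraMap R T) h)⟩

theorem IsIntegralClosure.isPrincipalIdealRing_of_padicInt
    (p : ℕ) [Fact p.Prime] (T : Type*) [Field T]
    [Algebra ℚ_[p] T] [FiniteDimensional ℚ_[p] T] [Algebra ℤ_[p] T] [IsScalarTower ℤ_[p] ℚ_[p] T]
    (R : Type*) [CommRing R] [Algebra R T] [IsIntegralClosure R ℤ_[p] T] :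
    IsPrincipalIdealRing R := by
  let e : R ≃+* integralClosure ℤ_[p] T :=
    RingEquiv.ofBijective ((algebraMap R T).codRestrict (integralClosure ℤ_[p] T)
      fun r => (IsIntegralClosure.isIntegral_iff (A := R)).2 ⟨r, rfl⟩)
      ⟨fun a b h => IsIntegralClosure.algebraMap_injective R ℤ_[p] T (congrArg Subtype.val h),
        fun ⟨x, hx⟩ => by
          obtain ⟨r, hr⟩ := (IsIntegralClosure.isIntegral_iff (A := R)).1 hx
          exact ⟨r, Subtype.ext hr⟩⟩
  have := IsIntegralClosure.isLocalRing_of_padicInt p T (integralClosure ℤ_[p] T)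
  have : IsDedekindDomain (integralClosure ℤ_[p] T) :=
    IsIntegralClosure.isDedekindDomain ℤ_[p] ℚ_[p] T _
  exact IsPrincipalIdealRing.of_surjective e.symm.toRingHom e.symm.surjective

section RootOfUnity

variable {R : Type*} [CommRing R] [IsDomain R] {p : ℕ} [Fact p.Prime] {ε : R}

theorem IsPrimitiveRoot.exists_mul_pow_sub_pow_eq (hε : IsPrimitiveRoot ε p) {i j : ℕ}
    (hi : i < p) (hj : j < p) (hij : i ≠ j) : ∃ c : R, c * (ε ^ i - ε ^ j) = 1 - ε := by
  have hp : p.Prime := Fact.out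
  have hlt : ∀ i j : ℕ, i < j → j < p → Associated (ε - 1) (ε ^ j - ε ^ i) := fun i j h hj => by
    obtain ⟨k, rfl⟩ := Nat.exists_eq_add_of_lt h
    have := hε.associated_pow_add_sub_sub_one hp.two_le i (j := k + 1)
      (Nat.coprime_of_lt_prime (by omega) (by omega) hp).symm
    simpa [add_assoc] using this
  rcases hij.lt_or_gt with h | h
  · obtain ⟨u, hu⟩ := (hlt i j h hj).symm
    exact ⟨u, by linear_combination -hu⟩
  · obtain ⟨u, hu⟩ := (hlt j i h hi).symm
    exact ⟨-u, by linear_combination -hu⟩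

theorem IsPrimitiveRoot.prod_one_sub_primitiveRoots (hε : IsPrimitiveRoot ε p) :
    ∏ μ ∈ primitiveRoots p R, (1 - μ) = p := by
  have h := congrArg (Polynomial.eval 1) (Polynomial.cyclotomic_eq_prod_X_sub_primitiveRoots hε)
  rw [Polynomial.eval_one_cyclotomic_prime, Polynomial.eval_prod] at h
  simpa using h.symm

theorem IsPrimitiveRoot.one_sub_sq_dvd_natCast (hε : IsPrimitiveRoot ε p) (hp : 2 < p) :
    (1 - ε) ^ 2 ∣ (p : R) := by
  have hp' : p.Prime := Fact.out
  classical
  have h2 : IsPrimitiveRoot (ε ^ 2) p :=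
    hε.pow_of_coprime 2 (Nat.coprime_of_lt_prime two_ne_zero hp hp').symm
  have hne : ε ≠ ε ^ 2 := fun h =>
    absurd (hε.pow_inj (i := 1) (j := 2) hp'.one_lt hp (by simpa using h)) (by norm_num)
  have hsub : ({ε, ε ^ 2} : Finset R) ⊆ primitiveRoots p R := by
    intro x hx
    rw [mem_primitiveRoots hp'.pos]
    rcases Finset.mem_insert.1 hx with rfl | hx
    · exact hε
    · rwa [Finset.mem_singleton.1 hx]
  refine Dvd.dvd.trans ?_ (hε.prod_one_sub_primitiveRoots ▸ Finset.prod_dvd_prod_of_subset _ _ _ hsub)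
  rw [Finset.prod_pair hne]
  exact ⟨1 + ε, by ring⟩

theorem IsPrimitiveRoot.not_isUnit_one_sub (hε : IsPrimitiveRoot ε p) (hu : ¬ IsUnit (p : R)) :
    ¬ IsUnit (1 - ε) := by
  have hp' : p.Prime := Fact.out
  refine fun h => hu ?_
  rw [← hε.prod_one_sub_primitiveRoots]
  refine (IsUnit.prod_iff).2 fun μ hμ => ?_
  obtain ⟨i, hi, rfl⟩ := hε.eq_pow_of_pow_eq_one ((mem_primitiveRoots hp'.pos).1 hμ).pow_eq_one
  have h0 : i ≠ 0 := by
    rintro rfl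
    exact ((mem_primitiveRoots hp'.pos).1 hμ).ne_one hp'.one_lt (pow_zero ε)
  obtain ⟨c, hc⟩ := hε.exists_mul_pow_sub_pow_eq hp'.pos hi h0.symm
  rw [pow_zero] at hc
  exact isUnit_of_dvd_unit ⟨c, by rw [mul_comm]; exact hc.symm⟩ h

end RootOfUnity

/-! Block matrices `D + N` with `D` diagonal and `N` supported in an off-diagonal rectangle. -/

section OffDiagonal

variable {ι R S : Type*} [Fintype ι] [DecidableEq ι] [CommRing R] [Ring S] [Algebra R S]

/-- The matrix `D + N`, where `D` is the diagonal matrix with the scalar entries `d i`. -/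
def scalarDiagAdd (d : ι → R) (N : Matrix ι ι S) : Matrix ι ι S :=
  Matrix.diagonal (fun i => algebraMap R S (d i)) + N

/-- The matrix `N` is supported in the rectangle of the `(i, j)` with `i ∈ L` and `j ∉ L`. -/
def SupportedOff (L : Set ι) (N : Matrix ι ι S) : Prop :=
  ∀ i j, ¬ (i ∈ L ∧ j ∉ L) → N i j = 0

variable {L : Set ι} {d : ι → R} {N N' N'' : Matrix ι ι S}

omit [DecidableEq ι] in
theorem SupportedOff.mul_eq_zero (hN : SupportedOff L N) (hN' : SupportedOff L N') :
    N * N' = 0 := by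
  ext i j
  rw [Matrix.mul_apply, Matrix.zero_apply]
  refine Finset.sum_eq_zero fun k _ => ?_
  by_cases hk : k ∈ L
  · rw [hN i k (by tauto), zero_mul]
  · rw [hN' k j (by tauto), mul_zero]

theorem scalarDiagAdd_pow (hN : SupportedOff L N) (n : ℕ) :
    scalarDiagAdd d N ^ n = scalarDiagAdd (fun i => d i ^ n)
      (Matrix.of fun i j => (∑ k ∈ Finset.range n, d i ^ k * d j ^ (n - 1 - k)) • N i j) := by
  induction n with
  | zero =>
    ext i j
    simp [scalarDiagAdd, Matrix.one_apply]
  | succ n ih =>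
    have h0 : (Matrix.of fun i j => (∑ k ∈ Finset.range n, d i ^ k * d j ^ (n - 1 - k)) • N i j) * N
        = 0 := SupportedOff.mul_eq_zero (L := L) (fun i j h => by simp [hN i j h]) hN
    rw [pow_succ, ih, scalarDiagAdd, scalarDiagAdd, scalarDiagAdd, mul_add, add_mul, add_mul, h0,
      add_zero, Matrix.diagonal_mul_diagonal, add_assoc]
    congr 1
    · simp [pow_succ]
    · ext i j
      simp only [Matrix.add_apply, Matrix.mul_diagonal, Matrix.diagonal_mul, Matrix.of_apply,
        Nat.add_sub_cancel]
      rw [geom_sum₂_succ_eq, ← Algebra.commutes, ← Algebra.smul_def, ← Algebra.smul_def, smul_smul,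
        add_smul, add_comm]

theorem scalarDiagAdd_pow_eq_one [IsDomain R] (hN : SupportedOff L N) {n : ℕ}
    (hd : ∀ i, d i ^ n = 1) (hd' : ∀ i j, i ≠ j → d i ≠ d j) : scalarDiagAdd d N ^ n = 1 := by
  rw [scalarDiagAdd_pow hN]
  have h0 : (Matrix.of fun i j => (∑ k ∈ Finset.range n, d i ^ k * d j ^ (n - 1 - k)) • N i j)
      = 0 := by
    ext i j
    rw [Matrix.of_apply, Matrix.zero_apply]
    by_cases h : i ∈ L ∧ j ∉ L
    · have hij : i ≠ j := fun hij => h.2 (hij ▸ h.1)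
      have h1 := (Commute.all (d i) (d j)).geom_sum₂_mul n
      rw [hd, hd, sub_self] at h1
      rw [(mul_eq_zero.1 h1).resolve_right (sub_ne_zero.2 (hd' i j hij)), zero_smul]
    · rw [hN i j h, smul_zero]
  simp [h0, scalarDiagAdd, hd]

/-- `Φ` intertwines `D + N` and `D + N'` if and only if its entries outside the diagonal are
supported in the rectangle and are determined by those on the diagonal. -/
theorem mul_scalarDiagAdd_eq_iff (hd : ∀ i j, i ≠ j → ∀ x : S, (d i - d j) • x = 0 → x = 0)
    (hN : SupportedOff L N) (hN' : SupportedOff L N') (Φ : Matrix ι ι S) :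
    Φ * scalarDiagAdd d N = scalarDiagAdd d N' * Φ ↔
      (∀ i j, i ≠ j → ¬ (i ∈ L ∧ j ∉ L) → Φ i j = 0) ∧
      ∀ i j, i ∈ L → j ∉ L → (d i - d j) • Φ i j = Φ i i * N i j - N' i j * Φ j j := by
  have hent : Φ * scalarDiagAdd d N = scalarDiagAdd d N' * Φ ↔
      ∀ i j, (d i - d j) • Φ i j = (Φ * N) i j - (N' * Φ) i j := by
    rw [← Matrix.ext_iff]
    refine forall₂_congr fun i j => ?_
    simp only [scalarDiagAdd, mul_add, add_mul, Matrix.add_apply, Matrix.mul_diagonal,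
      Matrix.diagonal_mul]
    rw [← Algebra.commutes, ← Algebra.smul_def, ← Algebra.smul_def, sub_smul, sub_eq_sub_iff_add_eq_add]
    constructor <;> intro h
    · rw [← h, add_comm]
    · rw [h, add_comm]
  rw [hent]
  have hr : ∀ i j, (∀ i j, i ≠ j → ¬ (i ∈ L ∧ j ∉ L) → Φ i j = 0) → i ∈ L → j ∉ L →
      (Φ * N) i j = Φ i i * N i j ∧ (N' * Φ) i j = N' i j * Φ j j := by
    intro i j h hi hj
    constructor
    · rw [Matrix.mul_apply]
      refine Finset.sum_eq_single i (fun k _ hk => ?_) (by simp)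
      by_cases hkL : k ∈ L
      · rw [h i k hk.symm (by tauto), zero_mul]
      · rw [hN k j (by tauto), mul_zero]
    · rw [Matrix.mul_apply]
      refine Finset.sum_eq_single j (fun k _ hk => ?_) (by simp)
      by_cases hkL : k ∈ L
      · rw [hN' i k (by tauto), zero_mul]
      · rw [h k j hk (by tauto), mul_zero]
  constructor
  · intro h
    have h1 : ∀ i j, i ∉ L → j ∈ L → Φ i j = 0 := by
      intro i j hi hj
      refine hd i j (fun hij => hi (hij ▸ hj)) _ ?_
      rw [h, Matrix.mul_apply, Matrix.mul_apply, Finset.sum_eq_zero, Finset.sum_eq_zero, sub_zero]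
      · exact fun k _ => by rw [hN' i k (by tauto), zero_mul]
      · exact fun k _ => by rw [hN k j (by tauto), mul_zero]
    have h2 : ∀ i j, i ≠ j → ¬ (i ∈ L ∧ j ∉ L) → Φ i j = 0 := by
      intro i j hij hL
      refine hd i j hij _ ?_
      rw [h, Matrix.mul_apply, Matrix.mul_apply, Finset.sum_eq_zero, Finset.sum_eq_zero, sub_zero]
      · intro k _
        by_cases hk : i ∈ L ∧ k ∉ L
        · rw [h1 k j hk.2 (by tauto), mul_zero]
        · rw [hN' i k hk, zero_mul]
      · intro k _
        by_cases hk : k ∈ L ∧ j ∉ L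
        · rw [h1 i k (by tauto) hk.1, zero_mul]
        · rw [hN k j hk, mul_zero]
    refine ⟨h2, fun i j hi hj => ?_⟩
    rw [h, (hr i j h2 hi hj).1, (hr i j h2 hi hj).2]
  · rintro ⟨h1, h2⟩ i j
    by_cases hL : i ∈ L ∧ j ∉ L
    · rw [h2 i j hL.1 hL.2, (hr i j h1 hL.1 hL.2).1, (hr i j h1 hL.1 hL.2).2]
    · have hl : (d i - d j) • Φ i j = 0 := by
        by_cases hij : i = j
        · rw [hij, sub_self, zero_smul]
        · rw [h1 i j hij hL, smul_zero]
      rw [hl, Matrix.mul_apply, Matrix.mul_apply, Finset.sum_eq_zero, Finset.sum_eq_zero, sub_zero]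
      · intro k _
        by_cases hk : i ∈ L ∧ k ∉ L
        · rw [h1 k j (fun hkj => hL (hkj ▸ hk)) (by tauto), mul_zero]
        · rw [hN' i k hk, zero_mul]
      · intro k _
        by_cases hk : k ∈ L ∧ j ∉ L
        · rw [h1 i k (fun hik => hL (hik ▸ hk)) (by tauto), zero_mul]
        · rw [hN k j hk, mul_zero]

/-- An intertwining matrix is determined by its diagonal. -/
theorem eq_of_mul_scalarDiagAdd_eq (hd : ∀ i j, i ≠ j → ∀ x : S, (d i - d j) • x = 0 → x = 0)
    (hN : SupportedOff L N) (hN' : SupportedOff L N') {Φ Ψ : Matrix ι ι S}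
    (hΦ : Φ * scalarDiagAdd d N = scalarDiagAdd d N' * Φ)
    (hΨ : Ψ * scalarDiagAdd d N = scalarDiagAdd d N' * Ψ) (h : ∀ i, Φ i i = Ψ i i) : Φ = Ψ := by
  have hs : (Φ - Ψ) * scalarDiagAdd d N = scalarDiagAdd d N' * (Φ - Ψ) := by
    rw [sub_mul, mul_sub, hΦ, hΨ]
  obtain ⟨h1, h2⟩ := (mul_scalarDiagAdd_eq_iff hd hN hN' _).1 hs
  have h0 : ∀ i, (Φ - Ψ) i i = 0 := fun i => sub_eq_zero.2 (h i)
  refine sub_eq_zero.1 (Matrix.ext fun i j => ?_)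
  rcases eq_or_ne i j with rfl | hij
  · exact h0 i
  by_cases hL : i ∈ L ∧ j ∉ L
  · refine hd i j hij _ ?_
    rw [h2 i j hL.1 hL.2, h0, h0, zero_mul, mul_zero, sub_zero]
  · exact h1 i j hij hL

/-- The diagonal entries of a product of intertwining matrices. -/
theorem mul_apply_self_of_mul_scalarDiagAdd_eq
    (hd : ∀ i j, i ≠ j → ∀ x : S, (d i - d j) • x = 0 → x = 0)
    (hN : SupportedOff L N) (hN' : SupportedOff L N') (hN'' : SupportedOff L N'')
    {Φ Ψ : Matrix ι ι S} (hΦ : Φ * scalarDiagAdd d N = scalarDiagAdd d N' * Φ)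
    (hΨ : Ψ * scalarDiagAdd d N' = scalarDiagAdd d N'' * Ψ) (i : ι) :
    (Ψ * Φ) i i = Ψ i i * Φ i i := by
  have h1 := ((mul_scalarDiagAdd_eq_iff hd hN hN' _).1 hΦ).1
  have h2 := ((mul_scalarDiagAdd_eq_iff hd hN' hN'' _).1 hΨ).1
  rw [Matrix.mul_apply]
  refine Finset.sum_eq_single i (fun k _ hk => ?_) (by simp)
  by_cases hL : k ∈ L ∧ i ∉ L
  · rw [h2 i k hk.symm (by tauto), zero_mul]
  · rw [h1 k i hk hL, mul_zero]

theorem exists_mul_scalarDiagAdd_eq (hd : ∀ i j, i ≠ j → ∀ x : S, (d i - d j) • x = 0 → x = 0)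
    (hN : SupportedOff L N) (hN' : SupportedOff L N') (P : S)
    (h : ∀ i j, i ∈ L → j ∉ L → ∃ x, (d i - d j) • x = P * N i j - N' i j * P) :
    ∃ Φ, Φ * scalarDiagAdd d N = scalarDiagAdd d N' * Φ ∧ ∀ i, Φ i i = P := by
  classical
  choose! Q hQ using h
  refine ⟨Matrix.of fun i j => if i = j then P else if i ∈ L ∧ j ∉ L then Q i j else 0,
    (mul_scalarDiagAdd_eq_iff hd hN hN' _).2 ⟨fun i j hij hL => ?_, fun i j hi hj => ?_⟩,
    fun i => by simp⟩
  · simp only [Matrix.of_apply, if_neg hij, if_neg hL]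
  · have hij : i ≠ j := fun hij => hj (hij ▸ hi)
    simp only [Matrix.of_apply, if_neg hij, if_pos (And.intro hi hj), if_true]
    exact hQ i j hi hj

end OffDiagonal

section GamBlock

theorem one_sub_dvd_pow_sub_pow {R : Type*} [CommRing R] (ε : R) (i j : ℕ) : 1 - ε ∣ ε ^ i - ε ^ j := by
  have h : ∀ i : ℕ, 1 - ε ∣ 1 - ε ^ i := fun i => by simpa using sub_dvd_pow_sub_pow 1 ε i
  have := (h j).sub (h i)
  simpa using this

theorem five_le_of_prime {p : ℕ} [Fact p.Prime] (hp : 3 < p) : 5 ≤ p := by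
  have hp' : p.Prime := Fact.out
  rcases Nat.lt_or_ge p 5 with h | h
  · obtain rfl : p = 4 := by omega
    exact absurd hp' (by norm_num)
  · exact h

variable {R S : Type*} [CommRing R] [Ring S] [Algebra R S]

/-- The rectangular part of `Γ`, scaled by `u`. -/
def gamOff (u : R) (a b : S) : Matrix (Fin 5) (Fin 5) S :=
  !![0, 0, u • 1, u • a, u • 1;
     0, 0, u • 1, u • 1, u • b;
     0, 0, 0, 0, 0;
     0, 0, 0, 0, 0;
     0, 0, 0, 0, 0]

/-- The matrix `Γ` over an arbitrary algebra, with its rectangular part scaled by `u`. -/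
def gamBlock (u ε : R) (a b : S) : Matrix (Fin 5) (Fin 5) S :=
  scalarDiagAdd (fun i : Fin 5 => ε ^ (i : ℕ)) (gamOff u a b)

theorem supportedOff_gamOff (u : R) (a b : S) :
    SupportedOff {i : Fin 5 | i < 2} (gamOff u a b) := by
  intro i j h
  fin_cases i <;> fin_cases j <;> first | rfl | exact absurd (by decide) h

theorem gamBlock_pow [IsDomain R] {p : ℕ} (hp : 3 < p) [Fact p.Prime] {ε : R}
    (hε : IsPrimitiveRoot ε p) (u : R) (a b : S) : gamBlock u ε a b ^ p = 1 := by
  have h5 := five_le_of_prime hp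
  refine scalarDiagAdd_pow_eq_one (supportedOff_gamOff u a b) (fun i => ?_) fun i j hij h => hij ?_
  · rw [← pow_mul, mul_comm, pow_mul, hε.pow_eq_one, one_pow]
  · exact Fin.ext (hε.pow_inj (by omega) (by omega) h)

theorem map_gamBlock {S' : Type*} [Ring S'] [Algebra R S'] (f : S →ₐ[R] S') (u ε : R) (a b : S) :
    (gamBlock u ε a b).map f = gamBlock u ε (f a) (f b) := by
  ext i j
  rw [Matrix.map_apply, gamBlock, gamBlock, scalarDiagAdd, scalarDiagAdd, Matrix.add_apply,
    Matrix.add_apply, map_add, Matrix.diagonal_apply, Matrix.diagonal_apply]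
  congr 1
  · split_ifs <;> simp
  · fin_cases i <;> fin_cases j <;> simp [gamOff]

end GamBlock

section GamMatrix

variable {R : Type*} [CommRing R] {m : ℕ}

local notation "𝕄" => Matrix (Fin m) (Fin m) R

/-- The matrix `Γ` with its rectangular part scaled by `u`. -/
def scaledGam (u ε : R) (A B : 𝕄) : Matrix (Fin 5 × Fin m) (Fin 5 × Fin m) R :=
  Matrix.compRingEquiv (Fin 5) (Fin m) R (gamBlock u ε A B)

theorem scaledGam_pow [IsDomain R] {p : ℕ} (hp : 3 < p) [Fact p.Prime] {ε : R}
    (hε : IsPrimitiveRoot ε p) (u : R) (A B : 𝕄) : scaledGam u ε A B ^ p = 1 := by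
  rw [scaledGam, ← map_pow, gamBlock_pow hp hε, map_one]

theorem scaledGam_one (ε : R) (A B : 𝕄) : scaledGam 1 ε A B = Gam ε A B := by
  rw [scaledGam, Gam, Matrix.compRingEquiv_apply]
  congr 1
  ext i j : 1
  fin_cases i <;> fin_cases j <;>
    simp [gamBlock, scalarDiagAdd, gamOff, Algebra.algebraMap_eq_smul_one]

theorem substPair_gamBlock (u ε : R) (A B : 𝕄) :
    substPair (gamBlock u ε (FreeAlgebra.ι R 0) (FreeAlgebra.ι R 1)) A B = scaledGam u ε A B := by
  rw [substPair, scaledGam]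
  congr 1
  have := map_gamBlock (FreeAlgebra.lift R ![A, B]) u ε (FreeAlgebra.ι R 0) (FreeAlgebra.ι R 1)
  simpa using this

variable [IsDomain R] {p : ℕ} [Fact p.Prime] {ε u s : R}

theorem smul_eq_zero_of_gamBlock (hp : 3 < p) (hε : IsPrimitiveRoot ε p) (i j : Fin 5) (hij : i ≠ j)
    (x : 𝕄) (hx : (ε ^ (i : ℕ) - ε ^ (j : ℕ)) • x = 0) : x = 0 := by
  have h5 := five_le_of_prime hp
  refine (smul_eq_zero.1 hx).resolve_left (sub_ne_zero.2 fun h => hij ?_)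
  exact Fin.ext (hε.pow_inj (by omega) (by omega) h)

theorem matMod_eq_matMod_iff {S : Type*} [CommRing S] (I : Ideal S) (A B : Matrix (Fin m) (Fin m) S) :
    matMod I A = matMod I B ↔ ∀ i j, A i j - B i j ∈ I := by
  rw [← Matrix.ext_iff]
  exact forall₂_congr fun i j => Ideal.Quotient.eq

theorem matMod_mul {S : Type*} [CommRing S] (I : Ideal S) (A B : Matrix (Fin m) (Fin m) S) :
    matMod I (A * B) = matMod I A * matMod I B :=
  map_mul (Ideal.Quotient.mk I).mapMatrix A B

theorem matMod_one {S : Type*} [CommRing S] (I : Ideal S) :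
    matMod I (1 : Matrix (Fin m) (Fin m) S) = 1 :=
  map_one (Ideal.Quotient.mk I).mapMatrix

theorem matMod_span_singleton_eq_iff {S : Type*} [CommRing S] (s : S)
    (A B : Matrix (Fin m) (Fin m) S) :
    matMod (Ideal.span {s}) A = matMod (Ideal.span {s}) B ↔ ∃ Z, s • Z = A - B := by
  rw [matMod_eq_matMod_iff]
  simp only [Ideal.mem_span_singleton]
  constructor
  · intro h
    choose Z hZ using h
    exact ⟨Matrix.of Z, by ext i j; simpa using (hZ i j).symm⟩
  · rintro ⟨Z, hZ⟩ i j
    exact ⟨Z i j, by simpa using (congrFun (congrFun hZ i) j).symm⟩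

/-- The entries `(i, j)` of an intertwining matrix exist if and only if the diagonal entries
satisfy a congruence. -/
theorem exists_smul_eq_iff_matMod_eq (hp : 3 < p) (hε : IsPrimitiveRoot ε p) (hu : u * s = 1 - ε)
    {i j : Fin 5} (hij : i ≠ j) (X Y : 𝕄) :
    (∃ x : 𝕄, (ε ^ (i : ℕ) - ε ^ (j : ℕ)) • x = u • X - u • Y) ↔
      matMod (Ideal.span {s}) X = matMod (Ideal.span {s}) Y := by
  have h5 := five_le_of_prime hp
  have h1 : 1 - ε ≠ 0 := sub_ne_zero.2 (hε.ne_one (Fact.out : p.Prime).one_lt).symm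
  have hu0 : u ≠ 0 := by rintro rfl; exact h1 (by rw [← hu, zero_mul])
  rw [matMod_span_singleton_eq_iff]
  constructor
  · rintro ⟨x, hx⟩
    obtain ⟨e, he⟩ := one_sub_dvd_pow_sub_pow ε i j
    refine ⟨e • x, smul_right_injective _ hu0 ?_⟩
    simp only
    rw [smul_sub, ← hx, he, ← hu, smul_smul, smul_smul]
  · rintro ⟨Z, hZ⟩
    obtain ⟨c, hc⟩ := hε.exists_mul_pow_sub_pow_eq (i := i) (j := j) (by omega) (by omega)
      (fun h => hij (Fin.ext h))
    refine ⟨c • Z, ?_⟩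
    rw [← smul_sub, ← hZ, smul_smul, smul_smul, mul_comm, hc, hu]

theorem exists_gamBlock_intertwining (hp : 3 < p) (hε : IsPrimitiveRoot ε p) (hu : u * s = 1 - ε)
    {A B A₁ B₁ : 𝕄} (P : 𝕄)
    (hA : matMod (Ideal.span {s}) (P * A) = matMod (Ideal.span {s}) (A₁ * P))
    (hB : matMod (Ideal.span {s}) (P * B) = matMod (Ideal.span {s}) (B₁ * P)) :
    ∃ Φ : Matrix (Fin 5) (Fin 5) 𝕄, Φ * gamBlock u ε A B = gamBlock u ε A₁ B₁ * Φ ∧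
      ∀ i, Φ i i = P := by
  refine exists_mul_scalarDiagAdd_eq (smul_eq_zero_of_gamBlock hp hε)
    (supportedOff_gamOff u A B) (supportedOff_gamOff u A₁ B₁) P fun i j hi hj => ?_
  have hij : i ≠ j := fun hij => hj (hij ▸ hi)
  have key := fun X Y => (exists_smul_eq_iff_matMod_eq hp hε hu hij (m := m) X Y).2
  fin_cases i <;> fin_cases j <;> first
    | exact absurd hi (by decide)
    | exact absurd (by decide) hj
    | (simp only [gamOff]
       first
       | (simp; done)
       | simpa using key (P * A) (A₁ * P) hA
       | simpa using key (P * B) (B₁ * P) hB)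

theorem matMod_diag_of_gamBlock_intertwining (hp : 3 < p) (hε : IsPrimitiveRoot ε p)
    (hu : u * s = 1 - ε) {A B A₁ B₁ : 𝕄} {Φ : Matrix (Fin 5) (Fin 5) 𝕄}
    (hΦ : Φ * gamBlock u ε A B = gamBlock u ε A₁ B₁ * Φ) :
    (∀ i, matMod (Ideal.span {s}) (Φ i i) = matMod (Ideal.span {s}) (Φ 0 0)) ∧
      matMod (Ideal.span {s}) (Φ 0 0 * A) = matMod (Ideal.span {s}) (A₁ * Φ 0 0) ∧
      matMod (Ideal.span {s}) (Φ 0 0 * B) = matMod (Ideal.span {s}) (B₁ * Φ 0 0) := by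
  have h := ((mul_scalarDiagAdd_eq_iff (smul_eq_zero_of_gamBlock hp hε)
    (supportedOff_gamOff u A B) (supportedOff_gamOff u A₁ B₁) Φ).1 hΦ).2
  have key : ∀ (i j : Fin 5) (X Y : 𝕄), i < 2 → ¬ j < 2 →
      Φ i i * gamOff u A B i j - gamOff u A₁ B₁ i j * Φ j j = u • X - u • Y →
      matMod (Ideal.span {s}) X = matMod (Ideal.span {s}) Y := fun i j X Y hi hj hXY =>
    (exists_smul_eq_iff_matMod_eq hp hε hu (fun hij : i = j => hj (hij ▸ hi)) X Y).1
      ⟨Φ i j, (h i j hi hj).trans hXY⟩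
  have h02 := key 0 2 (Φ 0 0) (Φ 2 2) (by decide) (by decide) (by simp [gamOff])
  have h03 := key 0 3 (Φ 0 0 * A) (A₁ * Φ 3 3) (by decide) (by decide) (by simp [gamOff])
  have h04 := key 0 4 (Φ 0 0) (Φ 4 4) (by decide) (by decide) (by simp [gamOff])
  have h12 := key 1 2 (Φ 1 1) (Φ 2 2) (by decide) (by decide) (by simp [gamOff])
  have h13 := key 1 3 (Φ 1 1) (Φ 3 3) (by decide) (by decide) (by simp [gamOff])
  have h14 := key 1 4 (Φ 1 1 * B) (B₁ * Φ 4 4) (by decide) (by decide) (by simp [gamOff])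
  have h1 : matMod (Ideal.span {s}) (Φ 1 1) = matMod (Ideal.span {s}) (Φ 0 0) := h12.trans h02.symm
  have h3 : matMod (Ideal.span {s}) (Φ 3 3) = matMod (Ideal.span {s}) (Φ 0 0) := h13.symm.trans h1
  refine ⟨fun i => ?_, ?_, ?_⟩
  · fin_cases i
    exacts [rfl, h1, h02.symm, h3, h04.symm]
  · rw [h03, matMod_mul, matMod_mul, h3]
  · rw [matMod_mul, ← h1, ← matMod_mul, h14, matMod_mul, matMod_mul, h04]

theorem eq_of_gamBlock_intertwining (hp : 3 < p) (hε : IsPrimitiveRoot ε p)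
    {A B A₁ B₁ : 𝕄} {Φ Ψ : Matrix (Fin 5) (Fin 5) 𝕄}
    (hΦ : Φ * gamBlock u ε A B = gamBlock u ε A₁ B₁ * Φ)
    (hΨ : Ψ * gamBlock u ε A B = gamBlock u ε A₁ B₁ * Ψ) (h : ∀ i, Φ i i = Ψ i i) : Φ = Ψ :=
  eq_of_mul_scalarDiagAdd_eq (smul_eq_zero_of_gamBlock hp hε)
    (supportedOff_gamOff u A B) (supportedOff_gamOff u A₁ B₁) hΦ hΨ h

theorem mul_apply_self_of_gamBlock_intertwining (hp : 3 < p) (hε : IsPrimitiveRoot ε p)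
    {A B A₁ B₁ A₂ B₂ : 𝕄} {Φ Ψ : Matrix (Fin 5) (Fin 5) 𝕄}
    (hΦ : Φ * gamBlock u ε A B = gamBlock u ε A₁ B₁ * Φ)
    (hΨ : Ψ * gamBlock u ε A₁ B₁ = gamBlock u ε A₂ B₂ * Ψ) (i : Fin 5) :
    (Ψ * Φ) i i = Ψ i i * Φ i i :=
  mul_apply_self_of_mul_scalarDiagAdd_eq (smul_eq_zero_of_gamBlock hp hε)
    (supportedOff_gamOff u A B) (supportedOff_gamOff u A₁ B₁) (supportedOff_gamOff u A₂ B₂) hΦ hΨ i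

omit [IsDomain R] in
theorem gamBlock_intertwining_mul {A B A₁ B₁ A₂ B₂ : 𝕄} {Φ Ψ : Matrix (Fin 5) (Fin 5) 𝕄}
    (hΦ : Φ * gamBlock u ε A B = gamBlock u ε A₁ B₁ * Φ)
    (hΨ : Ψ * gamBlock u ε A₁ B₁ = gamBlock u ε A₂ B₂ * Ψ) :
    Ψ * Φ * gamBlock u ε A B = gamBlock u ε A₂ B₂ * (Ψ * Φ) := by
  rw [mul_assoc, hΦ, ← mul_assoc, hΨ, mul_assoc]

theorem exists_gamBlock_equiv_iff (hp : 3 < p) (hε : IsPrimitiveRoot ε p)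
    (hu : u * s = 1 - ε) (A B A₁ B₁ : 𝕄) :
    (∃ Φ Ψ : Matrix (Fin 5) (Fin 5) 𝕄, Φ * gamBlock u ε A B = gamBlock u ε A₁ B₁ * Φ ∧
      Φ * Ψ = 1 ∧ Ψ * Φ = 1) ↔ PairSimilarMod (Ideal.span {s}) A B A₁ B₁ := by
  simp only [PairSimilarMod, ← matMod_eq_matMod_iff]
  constructor
  · rintro ⟨Φ, Ψ, hΦ, h1, h2⟩
    have hΨ : Ψ * gamBlock u ε A₁ B₁ = gamBlock u ε A B * Ψ := by
      calc Ψ * gamBlock u ε A₁ B₁ = Ψ * (gamBlock u ε A₁ B₁ * Φ) * Ψ := by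
            rw [mul_assoc, mul_assoc, h1, mul_one]
        _ = gamBlock u ε A B * Ψ := by rw [← hΦ, ← mul_assoc, h2, one_mul]
    have hd1 : Φ 0 0 * Ψ 0 0 = 1 := by
      rw [← mul_apply_self_of_gamBlock_intertwining hp hε hΨ hΦ, h1, Matrix.one_apply_eq]
    have hd2 : Ψ 0 0 * Φ 0 0 = 1 := by
      rw [← mul_apply_self_of_gamBlock_intertwining hp hε hΦ hΨ, h2, Matrix.one_apply_eq]
    obtain ⟨-, hA, hB⟩ := matMod_diag_of_gamBlock_intertwining hp hε hu hΦ
    refine ⟨⟨Ψ 0 0, Φ 0 0, hd2, hd1⟩, ?_, ?_⟩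
    · change matMod _ (Φ 0 0 * A * Ψ 0 0) = _
      rw [matMod_mul, hA, ← matMod_mul, mul_assoc, hd1, mul_one]
    · change matMod _ (Φ 0 0 * B * Ψ 0 0) = _
      rw [matMod_mul, hB, ← matMod_mul, mul_assoc, hd1, mul_one]
  · rintro ⟨C, hA, hB⟩
    have hC1 : C.val * (C⁻¹).val = 1 := C.mul_inv
    have hC2 : (C⁻¹).val * C.val = 1 := C.inv_mul
    have h1 : ∀ X X₁ : 𝕄, matMod (Ideal.span {s}) ((C⁻¹).val * X * C.val)
        = matMod (Ideal.span {s}) X₁ →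
        matMod (Ideal.span {s}) ((C⁻¹).val * X) = matMod (Ideal.span {s}) (X₁ * (C⁻¹).val) := by
      intro X X₁ h
      rw [matMod_mul _ X₁, ← h, ← matMod_mul, mul_assoc, hC1, mul_one]
    have h2 : ∀ X X₁ : 𝕄, matMod (Ideal.span {s}) ((C⁻¹).val * X * C.val)
        = matMod (Ideal.span {s}) X₁ →
        matMod (Ideal.span {s}) (C.val * X₁) = matMod (Ideal.span {s}) (X * C.val) := by
      intro X X₁ h
      rw [matMod_mul _ _ X₁, ← h, ← matMod_mul, ← mul_assoc, ← mul_assoc, hC1, one_mul]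
    obtain ⟨Φ, hΦ, hΦd⟩ := exists_gamBlock_intertwining hp hε hu _ (h1 A A₁ hA) (h1 B B₁ hB)
    obtain ⟨Ψ, hΨ, hΨd⟩ := exists_gamBlock_intertwining hp hε hu _ (h2 A A₁ hA) (h2 B B₁ hB)
    refine ⟨Φ, Ψ, hΦ, ?_, ?_⟩
    · refine eq_of_gamBlock_intertwining hp hε (gamBlock_intertwining_mul hΨ hΦ)
        ((one_mul _).trans (mul_one _).symm) fun i => ?_
      rw [mul_apply_self_of_gamBlock_intertwining hp hε hΨ hΦ, hΦd, hΨd, hC2, Matrix.one_apply_eq]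
    · refine eq_of_gamBlock_intertwining hp hε (gamBlock_intertwining_mul hΦ hΨ)
        ((one_mul _).trans (mul_one _).symm) fun i => ?_
      rw [mul_apply_self_of_gamBlock_intertwining hp hε hΦ hΨ, hΦd, hΨd, hC1, Matrix.one_apply_eq]

end GamMatrix

section Idempotents

theorem forall_isCompl_invariant_iff_idempotent {S V : Type*} [CommRing S] [AddCommGroup V]
    [Module S V] (T : Set (Module.End S V)) :
    (∀ U W : Submodule S V, (∀ f ∈ T, U ≤ U.comap f) → (∀ f ∈ T, W ≤ W.comap f) →
      IsCompl U W → U = ⊥ ∨ W = ⊥) ↔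
    ∀ e : Module.End S V, e * e = e → (∀ f ∈ T, e * f = f * e) → e = 0 ∨ e = 1 := by
  constructor
  · intro h e he hT
    have he' : IsIdempotentElem e := he
    have hc := fun f hf => (LinearMap.IsIdempotentElem.commute_iff he').1 (hT f hf)
    rcases h e.range e.ker (fun f hf => (hc f hf).1) (fun f hf => (hc f hf).2)
      (LinearMap.IsIdempotentElem.isCompl he') with h0 | h0
    · exact Or.inl (LinearMap.range_eq_bot.1 h0)
    · refine Or.inr (LinearMap.ext fun v => LinearMap.ker_eq_bot.1 h0 ?_)
      exact congrArg (fun g : Module.End S V => g v) he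
  · intro h U W hU hW hUW
    have he := Submodule.isIdempotentElem_projection hUW
    rcases h (U.projection W hUW) he fun f hf =>
      (LinearMap.IsIdempotentElem.commute_iff he).2 ⟨by
        rw [Submodule.range_projection]; exact hU f hf, by
        rw [Submodule.ker_projection]; exact hW f hf⟩ with h0 | h0
    · exact Or.inl (by rw [← Submodule.range_projection hUW, h0, LinearMap.range_zero])
    · exact Or.inr (by rw [← Submodule.ker_projection hUW, h0]; exact LinearMap.ker_id)

theorem IsCompl.free_left_of_isLocalRing {S V : Type*} [CommRing S] [IsLocalRing S]
    [AddCommGroup V] [Module S V] [Module.Free S V] [Module.Finite S V] {U W : Submodule S V}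
    (h : IsCompl U W) : Module.Finite S U ∧ Module.Free S U := by
  have hfin : Module.Finite S U :=
    Module.Finite.of_surjective (U.projectionOnto W h) (Submodule.projectionOnto_surjective h)
  have : Module.Projective S U := Module.Projective.of_split U.subtype (U.projectionOnto W h)
    (Submodule.projectionOnto_comp_subtype h)
  exact ⟨hfin, Module.free_of_flat_of_isLocalRing⟩

/-- Over a local ring, every idempotent matrix is conjugate to a diagonal matrix with entries
`0` and `1`. -/
theorem Matrix.exists_conj_diagonal_of_idempotent {S : Type*} [CommRing S] [IsLocalRing S] {m : ℕ}
    {e : Matrix (Fin m) (Fin m) S} (he : e * e = e) :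
    ∃ (C C' : Matrix (Fin m) (Fin m) S) (δ : Fin m → ℕ), C * C' = 1 ∧ (∀ i, δ i * δ i = δ i) ∧
      e * C = C * Matrix.diagonal (fun i => (δ i : S)) := by
  have hf : IsIdempotentElem (Matrix.toLin' e) := by
    exact (Matrix.toLin'_mul e e).symm.trans (by rw [he])
  have hc := LinearMap.IsIdempotentElem.isCompl hf
  obtain ⟨_, _⟩ := hc.free_left_of_isLocalRing
  obtain ⟨_, _⟩ := hc.symm.free_left_of_isLocalRing
  let b := ((Module.Free.chooseBasis S (Matrix.toLin' e).range).prod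
    (Module.Free.chooseBasis S (Matrix.toLin' e).ker)).map (Submodule.prodEquivOfIsCompl _ _ hc)
  let σ := b.indexEquiv (Pi.basisFun S (Fin m))
  let c := b.reindex σ
  let δ' : Module.Free.ChooseBasisIndex S (Matrix.toLin' e).range ⊕
    Module.Free.ChooseBasisIndex S (Matrix.toLin' e).ker → ℕ := Sum.elim (fun _ => 1) (fun _ => 0)
  have hb : ∀ i, Matrix.toLin' e (b i) = (δ' i : S) • b i := by
    rintro (i | i)
    · have : (b (Sum.inl i)) ∈ (Matrix.toLin' e).range := by simp [b]
      rw [(LinearMap.IsIdempotentElem.mem_range_iff hf).1 this]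
      simp [δ']
    · have : (b (Sum.inr i)) ∈ (Matrix.toLin' e).ker := by simp [b]
      rw [LinearMap.mem_ker.1 this]
      simp [δ']
  refine ⟨(Pi.basisFun S (Fin m)).toMatrix c, c.toMatrix (Pi.basisFun S (Fin m)),
    fun i => δ' (σ.symm i), Module.Basis.toMatrix_mul_toMatrix_flip _ _, fun i => ?_, ?_⟩
  · rcases h : σ.symm i with j | j <;> simp [δ', h]
  · ext k i
    have h := congrFun (hb (σ.symm i)) k
    rw [Matrix.mul_diagonal, mul_comm]
    simpa [Matrix.mul_apply, Matrix.mulVec, dotProduct, Module.Basis.toMatrix_apply, c] using h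

theorem isUnit_of_isUnit_matMod {R : Type*} [CommRing R] [IsLocalRing R] {I : Ideal R} (hI : I ≠ ⊤)
    {m : ℕ} {P : Matrix (Fin m) (Fin m) R} (h : IsUnit (matMod I P)) : IsUnit P := by
  have : Nontrivial (R ⧸ I) := Ideal.Quotient.nontrivial_iff.2 hI
  have := IsLocalHom.of_surjective (Ideal.Quotient.mk I) Ideal.Quotient.mk_surjective
  rw [Matrix.isUnit_iff_isUnit_det] at h ⊢
  refine isUnit_of_map_unit (Ideal.Quotient.mk I) _ ?_
  rwa [RingHom.map_det]

theorem exists_matMod_eq {R : Type*} [CommRing R] (I : Ideal R) {m : ℕ}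
    (X : Matrix (Fin m) (Fin m) (R ⧸ I)) : ∃ Y, matMod I Y = X := by
  choose Y hY using fun i j => Ideal.Quotient.mk_surjective (X i j)
  exact ⟨Matrix.of Y, Matrix.ext fun i j => hY i j⟩

/-- Idempotent matrices lift from a quotient of a local ring. -/
theorem exists_idempotent_matMod_eq {R : Type*} [CommRing R] [IsLocalRing R] {I : Ideal R}
    (hI : I ≠ ⊤) {m : ℕ} {e : Matrix (Fin m) (Fin m) (R ⧸ I)} (he : e * e = e) :
    ∃ P, P * P = P ∧ matMod I P = e := by
  have : Nontrivial (R ⧸ I) := Ideal.Quotient.nontrivial_iff.2 hI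
  have : IsLocalRing (R ⧸ I) := IsLocalRing.of_surjective' _ Ideal.Quotient.mk_surjective
  obtain ⟨C₀, C₀', δ, hC, hδ, heC⟩ := Matrix.exists_conj_diagonal_of_idempotent he
  obtain ⟨C, rfl⟩ := exists_matMod_eq I C₀
  obtain ⟨u, rfl⟩ := isUnit_of_isUnit_matMod hI (IsUnit.of_mul_eq_one _ hC)
  refine ⟨u.val * Matrix.diagonal (fun i => (δ i : R)) * (u⁻¹).val, ?_, ?_⟩
  · calc _ = u.val * Matrix.diagonal (fun i => (δ i : R)) * ((u⁻¹).val * u.val) *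
          Matrix.diagonal (fun i => (δ i : R)) * (u⁻¹).val := by simp only [mul_assoc]
      _ = _ := by
        rw [Units.inv_mul, mul_one, mul_assoc u.val, Matrix.diagonal_mul_diagonal]
        simp only [← Nat.cast_mul, hδ]
  · have hd : matMod I (Matrix.diagonal fun i => (δ i : R)) = Matrix.diagonal fun i => (δ i : R ⧸ I) := by
      ext i j
      simp [matMod, Matrix.diagonal_apply, apply_ite (Ideal.Quotient.mk I)]
    rw [matMod_mul, matMod_mul, hd, ← heC, mul_assoc, ← matMod_mul, Units.mul_inv, matMod_one,
      mul_one]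

theorem eq_zero_of_idempotent_of_matMod_eq_zero {R : Type*} [CommRing R] [IsLocalRing R]
    {I : Ideal R} (hI : I ≠ ⊤) {m : ℕ} {P : Matrix (Fin m) (Fin m) R} (hP : P * P = P)
    (h : matMod I P = 0) : P = 0 := by
  have h1 : matMod I (1 - P) = 1 := by
    have := map_sub (Ideal.Quotient.mk I).mapMatrix (1 : Matrix (Fin m) (Fin m) R) P
    change matMod I _ = matMod I 1 - matMod I P at this
    rw [this, h, sub_zero, matMod_one]
  obtain ⟨v, hv⟩ := isUnit_of_isUnit_matMod hI (P := 1 - P) (h1 ▸ isUnit_one)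
  have h2 : v.val * P = 0 := by rw [hv, sub_mul, one_mul, hP, sub_self]
  exact (Units.mul_right_eq_zero v).1 h2

/-- Over a local ring, two pairs are similar modulo a proper ideal `I` if and only if their
reductions are similar over the quotient by `I`. -/
theorem pairSimilar_matMod_iff {R : Type*} [CommRing R] [IsLocalRing R] {I : Ideal R} (hI : I ≠ ⊤) {m : ℕ}
    (A B A₁ B₁ : Matrix (Fin m) (Fin m) R) :
    PairSimilar (matMod I A) (matMod I B) (matMod I A₁) (matMod I B₁) ↔
      PairSimilarMod I A B A₁ B₁ := by
  simp only [PairSimilarMod, ← matMod_eq_matMod_iff]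
  constructor
  · rintro ⟨C₀, hA, hB⟩
    obtain ⟨C, hC⟩ := exists_matMod_eq I C₀.val
    obtain ⟨c, rfl⟩ := isUnit_of_isUnit_matMod hI (P := C) (hC ▸ C₀.isUnit)
    have hinv : (C₀⁻¹).val = matMod I (c⁻¹).val := by
      refine Units.inv_eq_of_mul_eq_one_right ?_
      rw [← hC, ← matMod_mul, Units.mul_inv, matMod_one]
    refine ⟨c, ?_, ?_⟩
    · rw [matMod_mul, matMod_mul, ← hinv, hC, hA]
    · rw [matMod_mul, matMod_mul, ← hinv, hC, hB]
  · rintro ⟨c, hA, hB⟩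
    refine ⟨Units.map (Ideal.Quotient.mk I).mapMatrix.toMonoidHom c, ?_, ?_⟩
    · rw [← hA, matMod_mul, matMod_mul]; rfl
    · rw [← hB, matMod_mul, matMod_mul]; rfl

end Idempotents

section CyclicRep

variable {R : Type*} [CommRing R] {κ : Type*} [Fintype κ] [DecidableEq κ] {p : ℕ} [Fact p.Prime]

theorem cyclicRep_cyclicGen (W : Matrix κ κ R) (h : W ^ p = 1) :
    cyclicRep W h (cyclicGen p) = Matrix.toLin' W := by
  have : (1 : ZMod p).val = 1 := ZMod.val_one p
  change Matrix.toLin' (W ^ (1 : ZMod p).val) = _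
  rw [this, pow_one]

theorem eq_cyclicGen_pow (g : Multiplicative (ZMod p)) :
    g = cyclicGen p ^ (Multiplicative.toAdd g).val := by
  apply Multiplicative.toAdd.injective
  rw [toAdd_pow, cyclicGen, toAdd_ofAdd, nsmul_one, ZMod.natCast_zmod_val]

/-- A linear map commutes with the action of a cyclic group as soon as it commutes with the
generator. -/
theorem forall_comp_eq_of_cyclicGen {V V' : Type*} [AddCommGroup V] [Module R V] [AddCommGroup V']
    [Module R V'] {ρ : Representation R (Multiplicative (ZMod p)) V}
    {ρ' : Representation R (Multiplicative (ZMod p)) V'} {φ : V →ₗ[R] V'}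
    (h : φ ∘ₗ ρ (cyclicGen p) = ρ' (cyclicGen p) ∘ₗ φ) (g : Multiplicative (ZMod p)) :
    φ ∘ₗ ρ g = ρ' g ∘ₗ φ := by
  rw [eq_cyclicGen_pow g]
  induction (Multiplicative.toAdd g).val with
  | zero => ext; simp
  | succ n ih =>
    rw [pow_succ, map_mul, map_mul, Module.End.mul_eq_comp, Module.End.mul_eq_comp,
      ← LinearMap.comp_assoc, ih, LinearMap.comp_assoc, h, LinearMap.comp_assoc]

theorem nonempty_cyclicRep_equiv_iff (W W' : Matrix κ κ R) (h : W ^ p = 1) (h' : W' ^ p = 1) :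
    Nonempty ((cyclicRep W h).Equiv (cyclicRep W' h')) ↔
      ∃ Φ Ψ : Matrix κ κ R, Φ * W = W' * Φ ∧ Φ * Ψ = 1 ∧ Ψ * Φ = 1 := by
  constructor
  · rintro ⟨φ⟩
    refine ⟨LinearMap.toMatrix' φ.toLinearMap, LinearMap.toMatrix' φ.symm.toLinearMap, ?_, ?_, ?_⟩
    · have := φ.isIntertwining' (cyclicGen p)
      rw [cyclicRep_cyclicGen, cyclicRep_cyclicGen] at this
      simpa [LinearMap.toMatrix'_comp] using congrArg LinearMap.toMatrix' this
    · rw [← LinearMap.toMatrix'_comp, ← LinearMap.toMatrix'_one]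
      congr 1
      exact LinearMap.ext φ.toLinearEquiv.apply_symm_apply
    · rw [← LinearMap.toMatrix'_comp, ← LinearMap.toMatrix'_one]
      congr 1
      exact LinearMap.ext φ.toLinearEquiv.symm_apply_apply
  · rintro ⟨Φ, Ψ, hW, h1, h2⟩
    refine ⟨Representation.Equiv.mk (Matrix.toLin'OfInv h2 h1) (forall_comp_eq_of_cyclicGen ?_)⟩
    rw [cyclicRep_cyclicGen, cyclicRep_cyclicGen]
    change Matrix.toLin' Φ ∘ₗ _ = _ ∘ₗ Matrix.toLin' Φ
    rw [← Matrix.toLin'_mul, hW, Matrix.toLin'_mul]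

theorem forall_matrix_idempotent_iff {P : Matrix κ κ R → Prop} {T : Set (Module.End R (κ → R))}
    (hP : ∀ X, P X ↔ ∀ f ∈ T, Matrix.toLin' X * f = f * Matrix.toLin' X) :
    (∀ e : Module.End R (κ → R), e * e = e → (∀ f ∈ T, e * f = f * e) → e = 0 ∨ e = 1) ↔
    ∀ X : Matrix κ κ R, X * X = X → P X → X = 0 ∨ X = 1 := by
  have key : ∀ X : Matrix κ κ R, (X * X = X ↔ Matrix.toLin' X * Matrix.toLin' X = Matrix.toLin' X) ∧
      (X = 0 ↔ Matrix.toLin' X = 0) ∧ (X = 1 ↔ Matrix.toLin' X = 1) := fun X => by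
    have hi := (Matrix.toLin' (R := R) (m := κ) (n := κ)).injective
    refine ⟨?_, ?_, ?_⟩
    · rw [← hi.eq_iff, Matrix.toLin'_mul]; rfl
    · rw [← hi.eq_iff, map_zero]
    · rw [← hi.eq_iff, Matrix.toLin'_one]; rfl
  constructor
  · intro h X hX hPX
    rw [(key X).2.1, (key X).2.2]
    exact h _ ((key X).1.1 hX) ((hP X).1 hPX)
  · intro h e he hT
    obtain ⟨X, rfl⟩ := (Matrix.toLin' (R := R) (m := κ) (n := κ)).surjective e
    rw [← (key X).2.1, ← (key X).2.2]
    exact h X ((key X).1.2 he) ((hP X).2 hT)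

theorem toLin'_mul_comm_iff (X W : Matrix κ κ R) :
    Matrix.toLin' X * Matrix.toLin' W = Matrix.toLin' W * Matrix.toLin' X ↔ X * W = W * X := by
  rw [← (Matrix.toLin' (R := R) (m := κ) (n := κ)).injective.eq_iff, Matrix.toLin'_mul,
    Matrix.toLin'_mul]
  rfl

theorem repIndecomposable_cyclicRep_iff (W : Matrix κ κ R) (h : W ^ p = 1) :
    RepIndecomposable (cyclicRep W h) ↔ Nontrivial (κ → R) ∧
      ∀ X : Matrix κ κ R, X * X = X → X * W = W * X → X = 0 ∨ X = 1 := by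
  rw [RepIndecomposable, ← forall_matrix_idempotent_iff
    (T := Set.range (cyclicRep W h)), ← forall_isCompl_invariant_iff_idempotent]
  · simp only [Set.forall_mem_range]
  · intro X
    rw [Set.forall_mem_range]
    rw [← toLin'_mul_comm_iff, ← cyclicRep_cyclicGen W h]
    exact ⟨fun hX g => forall_comp_eq_of_cyclicGen hX g, fun hX => hX _⟩

theorem pairIndecomposable_iff {m : ℕ} (A B : Matrix (Fin m) (Fin m) R) :
    PairIndecomposable A B ↔ Nontrivial (Fin m → R) ∧
      ∀ X : Matrix (Fin m) (Fin m) R, X * X = X → X * A = A * X ∧ X * B = B * X →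
        X = 0 ∨ X = 1 := by
  rw [PairIndecomposable, ← forall_matrix_idempotent_iff
    (T := {Matrix.toLin' A, Matrix.toLin' B}), ← forall_isCompl_invariant_iff_idempotent]
  · simp only [Set.mem_insert_iff, Set.mem_singleton_iff, forall_eq_or_imp, forall_eq,
      SetLike.le_def, Submodule.mem_comap, Matrix.toLin'_apply, forall_and]
  · intro X
    simp only [Set.mem_insert_iff, Set.mem_singleton_iff, forall_eq_or_imp, forall_eq,
      toLin'_mul_comm_iff]

end CyclicRep

section ScaledGam

variable {R : Type*} [CommRing R] [IsDomain R] {p : ℕ} [Fact p.Prime] {ε u s : R} {m : ℕ}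

theorem nonempty_cyclicRep_scaledGam_equiv_iff (hp : 3 < p) (hε : IsPrimitiveRoot ε p)
    (hu : u * s = 1 - ε) (A B A₁ B₁ : Matrix (Fin m) (Fin m) R)
    (h : scaledGam u ε A B ^ p = 1) (h₁ : scaledGam u ε A₁ B₁ ^ p = 1) :
    Nonempty ((cyclicRep (scaledGam u ε A B) h).Equiv (cyclicRep (scaledGam u ε A₁ B₁) h₁)) ↔
      PairSimilarMod (Ideal.span {s}) A B A₁ B₁ := by
  rw [nonempty_cyclicRep_equiv_iff, ← exists_gamBlock_equiv_iff hp hε hu]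
  have hs := (Matrix.compRingEquiv (Fin 5) (Fin m) R).surjective
  have hi := (Matrix.compRingEquiv (Fin 5) (Fin m) R).injective
  rw [hs.exists]
  refine exists_congr fun Φ => ?_
  rw [hs.exists]
  refine exists_congr fun Ψ => ?_
  simp only [scaledGam, ← map_mul, hi.eq_iff, ← map_one (Matrix.compRingEquiv (Fin 5) (Fin m) R)]

theorem repIndecomposable_cyclicRep_scaledGam_iff [IsLocalRing R] (hp : 3 < p)
    (hε : IsPrimitiveRoot ε p) (hu : u * s = 1 - ε) (hs : ¬ IsUnit s)
    (A B : Matrix (Fin m) (Fin m) R) (h : scaledGam u ε A B ^ p = 1) :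
    RepIndecomposable (cyclicRep (scaledGam u ε A B) h) ↔
      PairIndecomposable (matMod (Ideal.span {s}) A) (matMod (Ideal.span {s}) B) := by
  have hI : Ideal.span {s} ≠ ⊤ := by rwa [Ne, Ideal.span_singleton_eq_top]
  have : Nontrivial (R ⧸ Ideal.span {s}) := Ideal.Quotient.nontrivial_iff.2 hI
  rw [repIndecomposable_cyclicRep_iff, pairIndecomposable_iff]
  have hsurj := (Matrix.compRingEquiv (Fin 5) (Fin m) R).surjective
  have hi := (Matrix.compRingEquiv (Fin 5) (Fin m) R).injective
  refine and_congr ?_ ?_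
  · rcases Nat.eq_zero_or_pos m with rfl | hm
    · exact iff_of_false (not_nontrivial _) (not_nontrivial _)
    · have : Nonempty (Fin m) := ⟨⟨0, hm⟩⟩
      exact ⟨fun _ => inferInstance, fun _ => inferInstance⟩
  · rw [hsurj.forall]
    simp only [scaledGam, ← map_mul, hi.eq_iff, map_eq_zero_iff _ hi, map_eq_one_iff _ hi]
    constructor
    · rintro H e he ⟨hA, hB⟩
      obtain ⟨P, hP, rfl⟩ := exists_idempotent_matMod_eq hI he
      rw [← matMod_mul, ← matMod_mul] at hA hB
      obtain ⟨Φ, hΦ, hΦd⟩ := exists_gamBlock_intertwining hp hε hu P hA hB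
      have hΦ2 : Φ * Φ = Φ :=
        eq_of_gamBlock_intertwining hp hε (gamBlock_intertwining_mul hΦ hΦ) hΦ fun i => by
          rw [mul_apply_self_of_gamBlock_intertwining hp hε hΦ hΦ, hΦd, hP]
      rcases H Φ hΦ2 hΦ with rfl | rfl
      · left
        rw [← hΦd 0]
        exact map_zero (Ideal.Quotient.mk (Ideal.span {s})).mapMatrix
      · right
        rw [← hΦd 0]
        exact map_one (Ideal.Quotient.mk (Ideal.span {s})).mapMatrix
    · have hzero : ∀ Φ : Matrix (Fin 5) (Fin 5) (Matrix (Fin m) (Fin m) R), Φ * Φ = Φ →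
          Φ * gamBlock u ε A B = gamBlock u ε A B * Φ →
          matMod (Ideal.span {s}) (Φ 0 0) = 0 → Φ = 0 := by
        intro Φ hΦ2 hΦ h0
        refine eq_of_gamBlock_intertwining hp hε hΦ ((zero_mul _).trans (mul_zero _).symm) fun i => ?_
        refine eq_zero_of_idempotent_of_matMod_eq_zero hI ?_
          (((matMod_diag_of_gamBlock_intertwining hp hε hu hΦ).1 i).trans h0)
        rw [← mul_apply_self_of_gamBlock_intertwining hp hε hΦ hΦ, hΦ2]
      intro H Φ hΦ2 hΦ
      obtain ⟨-, hA, hB⟩ := matMod_diag_of_gamBlock_intertwining hp hε hu hΦ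
      rw [matMod_mul, matMod_mul] at hA hB
      have hd : matMod (Ideal.span {s}) (Φ 0 0) * matMod (Ideal.span {s}) (Φ 0 0)
          = matMod (Ideal.span {s}) (Φ 0 0) := by
        rw [← matMod_mul, ← mul_apply_self_of_gamBlock_intertwining hp hε hΦ hΦ, hΦ2]
      rcases H _ hd ⟨hA, hB⟩ with h0 | h1
      · exact Or.inl (hzero Φ hΦ2 hΦ h0)
      · refine Or.inr (sub_eq_zero.1 (hzero (1 - Φ) ?_ ?_ ?_)).symm
        · rw [sub_mul, mul_sub, mul_sub, hΦ2]; simp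
        · rw [sub_mul, mul_sub, hΦ, one_mul, mul_one]
        · have := map_sub (Ideal.Quotient.mk (Ideal.span {s})).mapMatrix 1 (Φ 0 0)
          change matMod _ (1 - Φ 0 0) = matMod _ 1 - matMod _ (Φ 0 0) at this
          rw [Matrix.sub_apply, Matrix.one_apply_eq, this, h1, matMod_one, sub_self]

end ScaledGam

section CyclicCocycles

variable {R V : Type*} [CommRing R] [AddCommGroup V] [Module R V] {p : ℕ} [Fact p.Prime]
  {σ : Representation R (Multiplicative (ZMod p)) V}

theorem oneCocycles_map_one {G : Type*} [Group G] {σ : Representation R G V} (f : oneCocycles σ) :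
    f.1 1 = 0 := by
  have h := f.2 1 1
  simpa using h

/-- A `1`-cocycle of a cyclic group is determined by its value at the generator. -/
theorem oneCocycles_ext_cyclicGen {f g : oneCocycles σ}
    (h : f.1 (cyclicGen p) = g.1 (cyclicGen p)) : f = g := by
  refine Subtype.ext (funext fun x => ?_)
  rw [eq_cyclicGen_pow x]
  induction (Multiplicative.toAdd x).val with
  | zero => rw [pow_zero, oneCocycles_map_one, oneCocycles_map_one]
  | succ n ih => rw [pow_succ, f.2, g.2, h, ih]

theorem exists_oneCocycle_of_fixed {v : V} (h : σ (cyclicGen p) v = v) (hp : p • v = 0) :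
    ∃ f : oneCocycles σ, f.1 (cyclicGen p) = v := by
  have hfix : ∀ g, σ g v = v := fun g => by
    rw [eq_cyclicGen_pow g, map_pow]
    exact Function.iterate_fixed h _ |> fun h' => by rwa [Module.End.pow_apply]
  refine ⟨⟨fun g => (Multiplicative.toAdd g).val • v, fun x y => ?_⟩, ?_⟩
  · change (Multiplicative.toAdd (x * y)).val • v =
      σ x ((Multiplicative.toAdd y).val • v) + (Multiplicative.toAdd x).val • v
    rw [map_nsmul, hfix, toAdd_mul, ZMod.val_add, ← add_smul, add_comm (Multiplicative.toAdd y).val]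
    conv_rhs => rw [← Nat.mod_add_div
      ((Multiplicative.toAdd x).val + (Multiplicative.toAdd y).val) p, add_smul, mul_comm p,
      mul_smul, hp, smul_zero, add_zero]
  · change (1 : ZMod p).val • v = v
    rw [ZMod.val_one, one_smul]

/-- The coboundary of a vector. -/
def coboundary {G : Type*} [Group G] (σ : Representation R G V) (v : V) : oneCocycles σ :=
  ⟨fun g => σ g v - v, fun x y => by simp⟩

theorem mem_oneCoboundaries_iff_cyclicGen (f : oneCocycles σ) :
    f ∈ oneCoboundaries σ ↔ ∃ v, f.1 (cyclicGen p) = σ (cyclicGen p) v - v := by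
  constructor
  · rintro ⟨v, hv⟩
    exact ⟨v, hv _⟩
  · rintro ⟨v, hv⟩
    have h : f = coboundary σ v := oneCocycles_ext_cyclicGen hv
    exact ⟨v, fun g => by rw [h]; rfl⟩

end CyclicCocycles

section Coordinates

variable {R : Type*} [CommRing R] {κ : Type*} [Fintype κ] [DecidableEq κ] {p : ℕ} [Fact p.Prime]
  {F : Type*} [Field F] [Algebra R F]

theorem mem_lattice_pi_iff (z : F ⊗[R] (κ → R)) :
    z ∈ lattice R (κ → R) F ↔
      ∀ k, TensorProduct.piScalarRight R F F κ z k ∈ (algebraMap R F).range := by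
  constructor
  · rintro ⟨v, rfl⟩ k
    exact ⟨v k, by simp [Algebra.smul_def]⟩
  · intro h
    choose r hr using h
    refine ⟨r, (TensorProduct.piScalarRight R F F κ).injective (funext fun k => ?_)⟩
    rw [← hr]
    simp [Algebra.smul_def]

theorem piScalarRight_scalarExt_cyclicGen (W : Matrix κ κ R) (h : W ^ p = 1)
    (z : F ⊗[R] (κ → R)) :
    TensorProduct.piScalarRight R F F κ (scalarExt F (cyclicRep W h) (cyclicGen p) z) =
      (W.map (algebraMap R F)).mulVec (TensorProduct.piScalarRight R F F κ z) := by
  induction z with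
  | zero => simp
  | add x y hx hy => rw [map_add, map_add, hx, hy, map_add, Matrix.mulVec_add]
  | tmul x v =>
    have h1 : scalarExt F (cyclicRep W h) (cyclicGen p) (x ⊗ₜ[R] v) = x ⊗ₜ[R] W.mulVec v := by
      rw [← Matrix.toLin'_apply, ← cyclicRep_cyclicGen W h]
      simp [scalarExt]
    rw [h1]
    ext k
    simp [Matrix.mulVec, dotProduct, Algebra.smul_def, Finset.sum_mul, mul_assoc]

variable {m : ℕ}

theorem piScalarRight_firstBlock (X : Fin m → F) (k : Fin 5 × Fin m) :
    TensorProduct.piScalarRight R F F (Fin 5 × Fin m)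
      (∑ j, X j ⊗ₜ[R] (Pi.single ((0 : Fin 5), j) (1 : R))) k = if k.1 = 0 then X k.2 else 0 := by
  obtain ⟨i, l⟩ := k
  rw [map_sum, Finset.sum_apply]
  by_cases hi : i = 0
  · subst hi
    rw [Finset.sum_eq_single l] <;> simp +contextual [eq_comm]
  · simp [hi]

theorem scaledGam_mulVec (u ε : R) (A B : Matrix (Fin m) (Fin m) R) (w : Fin 5 × Fin m → F)
    (i : Fin 5) (j : Fin m) :
    ((scaledGam u ε A B).map (algebraMap R F)).mulVec w (i, j) =
      algebraMap R F ε ^ (i : ℕ) * w (i, j) +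
        ∑ k, ∑ l, algebraMap R F (gamOff u A B i k j l) * w (k, l) := by
  simp only [Matrix.mulVec, dotProduct, Fintype.sum_prod_type, Matrix.map_apply]
  have h : ∀ k l, scaledGam u ε A B (i, j) (k, l) =
      (if (i, j) = (k, l) then ε ^ (i : ℕ) else 0) + gamOff u A B i k j l := by
    intro k l
    change gamBlock u ε A B i k j l = _
    rw [gamBlock, scalarDiagAdd, Matrix.add_apply, Matrix.add_apply, Matrix.diagonal_apply]
    congr 1
    by_cases hik : i = k
    · simp [hik, Matrix.algebraMap_matrix_apply]
    · simp [hik]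
  simp only [h, map_add, add_mul, Finset.sum_add_distrib]
  congr 1
  rw [← Fintype.sum_prod_type (f := fun x : Fin 5 × Fin m =>
    algebraMap R F (if (i, j) = x then ε ^ (i : ℕ) else 0) * w x)]
  simp [apply_ite (algebraMap R F), ite_mul]

theorem scaledGam_mulVec_zero (u ε : R) (A B : Matrix (Fin m) (Fin m) R) (w : Fin 5 × Fin m → F)
    (j : Fin m) :
    ((scaledGam u ε A B).map (algebraMap R F)).mulVec w (0, j) - w (0, j) =
      algebraMap R F u * (w (2, j) + ∑ l, algebraMap R F (A j l) * w (3, l) + w (4, j)) := by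
  rw [scaledGam_mulVec, Fin.sum_univ_five]
  simp [gamOff, Matrix.one_apply, apply_ite (algebraMap R F), ite_mul, mul_add, Finset.mul_sum, mul_assoc]

theorem scaledGam_mulVec_one (u ε : R) (A B : Matrix (Fin m) (Fin m) R) (w : Fin 5 × Fin m → F)
    (j : Fin m) :
    ((scaledGam u ε A B).map (algebraMap R F)).mulVec w (1, j) - w (1, j) =
      (algebraMap R F ε - 1) * w (1, j) +
      algebraMap R F u * (w (2, j) + w (3, j) + ∑ l, algebraMap R F (B j l) * w (4, l)) := by
  rw [scaledGam_mulVec, Fin.sum_univ_five]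
  simp [gamOff, Matrix.one_apply, apply_ite (algebraMap R F), ite_mul, mul_add, Finset.mul_sum, mul_assoc]
  ring

theorem scaledGam_mulVec_of_two_le (u ε : R) (A B : Matrix (Fin m) (Fin m) R)
    (w : Fin 5 × Fin m → F) {i : Fin 5} (hi : 2 ≤ i) (j : Fin m) :
    ((scaledGam u ε A B).map (algebraMap R F)).mulVec w (i, j) - w (i, j) =
      (algebraMap R F ε ^ (i : ℕ) - 1) * w (i, j) := by
  have h0 : ∀ k, gamOff u A B i k = 0 := fun k =>
    supportedOff_gamOff u A B i k fun h => absurd h.1 (not_lt.2 hi)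
  rw [scaledGam_mulVec]
  simp only [h0, Matrix.zero_apply, map_zero, zero_mul, Finset.sum_const_zero]
  ring

theorem firstBlock_eq_iff (X : Fin m → F) (z : F ⊗[R] (Fin 5 × Fin m → R)) :
    (lattice R (Fin 5 × Fin m → R) F).mkQ z = firstBlock R X ↔
      ∀ k : Fin 5 × Fin m, TensorProduct.piScalarRight R F F (Fin 5 × Fin m) z k -
        (if k.1 = 0 then X k.2 else 0) ∈ (algebraMap R F).range := by
  rw [firstBlock, ← sub_eq_zero, ← map_sub, Submodule.mkQ_apply, Submodule.Quotient.mk_eq_zero,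
    mem_lattice_pi_iff]
  simp only [map_sub, Pi.sub_apply, piScalarRight_firstBlock]

theorem firstBlock_sub (X Y : Fin m → F) :
    firstBlock R (X - Y) = firstBlock R X - firstBlock R Y := by
  simp only [firstBlock, Pi.sub_apply, TensorProduct.sub_tmul, Finset.sum_sub_distrib, map_sub]

theorem existsUnique_oneCocycle_firstBlock (u ε : R) (A B : Matrix (Fin m) (Fin m) R)
    (h : scaledGam u ε A B ^ p = 1) (X : Fin m → F)
    (hX : ∀ j, ∃ r : R, algebraMap R F r = (p : F) * X j) :
    ∃! f : oneCocycles (hatRep F (cyclicRep (scaledGam u ε A B) h)),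
      f.1 (cyclicGen p) = firstBlock R X := by
  refine existsUnique_of_exists_of_unique (exists_oneCocycle_of_fixed ?_ ?_)
    fun f g hf hg => oneCocycles_ext_cyclicGen (hf.trans hg.symm)
  · change (lattice R (Fin 5 × Fin m → R) F).mkQ (scalarExt F _ _ _) = _
    rw [firstBlock_eq_iff]
    rintro ⟨i, j⟩
    have hz : ((scaledGam u ε A B).map (algebraMap R F)).mulVec
        (fun k => if k.1 = 0 then X k.2 else 0) (i, j) - (if i = 0 then X j else 0) = 0 := by
      set w : Fin 5 × Fin m → F := fun k => if k.1 = 0 then X k.2 else 0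
      change _ - w (i, j) = 0
      rcases lt_or_ge i 2 with hi | hi
      · obtain rfl | rfl : i = 0 ∨ i = 1 := by omega
        · rw [scaledGam_mulVec_zero]; simp [w]
        · rw [scaledGam_mulVec_one]; simp [w]
      · rw [scaledGam_mulVec_of_two_le _ _ _ _ _ hi]
        have : i ≠ 0 := by rintro rfl; exact absurd hi (by decide)
        simp [w, this]
    rw [piScalarRight_scalarExt_cyclicGen, funext (piScalarRight_firstBlock X), hz]
    exact zero_mem _
  · rw [firstBlock, ← map_nsmul, Submodule.mkQ_apply, Submodule.Quotient.mk_eq_zero,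
      mem_lattice_pi_iff]
    intro k
    rw [map_nsmul, Pi.smul_apply, piScalarRight_firstBlock]
    split_ifs
    · rw [nsmul_eq_mul]; exact hX k.2
    · rw [smul_zero]; exact zero_mem _

theorem sub_mem_oneCoboundaries_iff_exists (u ε : R) (A B : Matrix (Fin m) (Fin m) R)
    (h : scaledGam u ε A B ^ p = 1) {X Y : Fin m → F}
    {f g : oneCocycles (hatRep F (cyclicRep (scaledGam u ε A B) h))}
    (hf : f.1 (cyclicGen p) = firstBlock R X) (hg : g.1 (cyclicGen p) = firstBlock R Y) :
    f - g ∈ oneCoboundaries (hatRep F (cyclicRep (scaledGam u ε A B) h)) ↔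
      ∃ w : Fin 5 × Fin m → F, ∀ k : Fin 5 × Fin m,
        ((scaledGam u ε A B).map (algebraMap R F)).mulVec w k - w k -
          (if k.1 = 0 then X k.2 - Y k.2 else 0) ∈ (algebraMap R F).range := by
  rw [mem_oneCoboundaries_iff_cyclicGen]
  have hfg : (f - g).1 (cyclicGen p) = firstBlock R (X - Y) := by
    rw [firstBlock_sub, ← hf, ← hg]; rfl
  rw [hfg, (Submodule.mkQ_surjective _).exists]
  rw [(TensorProduct.piScalarRight R F F (Fin 5 × Fin m)).surjective.exists]
  refine exists_congr fun z => ?_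
  rw [eq_comm]
  change (lattice R (Fin 5 × Fin m → R) F).mkQ (scalarExt F _ _ z - z) = _ ↔ _
  rw [firstBlock_eq_iff, map_sub, piScalarRight_scalarExt_cyclicGen]
  rfl

variable [IsDomain R] {ε u : R}

theorem mul_mem_range_of_sub_mem_oneCoboundaries (hp : 3 < p) (hε : IsPrimitiveRoot ε p)
    (A B : Matrix (Fin m) (Fin m) R) (h : scaledGam u ε A B ^ p = 1) {X Y : Fin m → F}
    {f g : oneCocycles (hatRep F (cyclicRep (scaledGam u ε A B) h))}
    (hf : f.1 (cyclicGen p) = firstBlock R X) (hg : g.1 (cyclicGen p) = firstBlock R Y)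
    (hfg : f - g ∈ oneCoboundaries (hatRep F (cyclicRep (scaledGam u ε A B) h))) (j : Fin m) :
    (1 - algebraMap R F ε) * (X j - Y j) ∈ (algebraMap R F).range := by
  obtain ⟨w, hw⟩ := (sub_mem_oneCoboundaries_iff_exists u ε A B h hf hg).1 hfg
  have h5 := five_le_of_prime hp
  have hmem : ∀ r : R, algebraMap R F r ∈ (algebraMap R F).range := fun r => ⟨r, rfl⟩
  have ht : 1 - algebraMap R F ε ∈ (algebraMap R F).range := by
    simpa using hmem (1 - ε)
  have h2 : ∀ i : Fin 5, 2 ≤ i → ∀ l, (1 - algebraMap R F ε) * w (i, l) ∈ (algebraMap R F).range := by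
    intro i hi l
    have hi0 : i ≠ 0 := by rintro rfl; exact absurd hi (by decide)
    have h1 := hw (i, l)
    rw [scaledGam_mulVec_of_two_le _ _ _ _ _ hi, if_neg hi0, sub_zero] at h1
    obtain ⟨c, hc⟩ := hε.exists_mul_pow_sub_pow_eq (i := i) (j := 0) (by omega) (by omega)
      (fun h => hi0 (Fin.ext h))
    have hc' := congrArg (algebraMap R F) hc
    simp only [map_mul, map_sub, map_pow, map_one, pow_zero] at hc'
    rw [← hc', mul_assoc]
    exact mul_mem (hmem c) h1
  have h0 := hw (0, j)
  rw [scaledGam_mulVec_zero, if_pos rfl] at h0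
  have h3 : (1 - algebraMap R F ε) * (X j - Y j) =
      algebraMap R F u * ((1 - algebraMap R F ε) * w (2, j) +
        ∑ l, algebraMap R F (A j l) * ((1 - algebraMap R F ε) * w (3, l)) +
        (1 - algebraMap R F ε) * w (4, j)) - (1 - algebraMap R F ε) *
      (algebraMap R F u * (w (2, j) + ∑ l, algebraMap R F (A j l) * w (3, l) + w (4, j)) -
        (X j - Y j)) := by
    have : ∑ l, algebraMap R F (A j l) * ((1 - algebraMap R F ε) * w (3, l)) =
        (1 - algebraMap R F ε) * ∑ l, algebraMap R F (A j l) * w (3, l) := by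
      rw [Finset.mul_sum]
      exact Finset.sum_congr rfl fun l _ => by ring
    rw [this]
    ring
  rw [h3]
  exact sub_mem (mul_mem (hmem u) (add_mem (add_mem (h2 2 (by decide) j)
    (sum_mem fun l _ => mul_mem (hmem _) (h2 3 (by decide) l))) (h2 4 (by decide) j)))
    (mul_mem ht h0)

variable [FaithfulSMul R F]

omit [IsDomain R] in
theorem one_sub_algebraMap_ne_zero (hε : IsPrimitiveRoot ε p) : 1 - algebraMap R F ε ≠ 0 := by
  have h1 : 1 - ε ≠ 0 := sub_ne_zero.2 (hε.ne_one (Fact.out : p.Prime).one_lt).symm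
  have := (map_ne_zero_iff _ (FaithfulSMul.algebraMap_injective R F)).2 h1
  simpa using this

omit [IsDomain R] in
theorem sub_mem_oneCoboundaries_of_mul_mem_range (hε : IsPrimitiveRoot ε p)
    (A B : Matrix (Fin m) (Fin m) R) (h : scaledGam 1 ε A B ^ p = 1) {X Y : Fin m → F}
    {f g : oneCocycles (hatRep F (cyclicRep (scaledGam 1 ε A B) h))}
    (hf : f.1 (cyclicGen p) = firstBlock R X) (hg : g.1 (cyclicGen p) = firstBlock R Y)
    (hXY : ∀ j, (1 - algebraMap R F ε) * (X j - Y j) ∈ (algebraMap R F).range) :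
    f - g ∈ oneCoboundaries (hatRep F (cyclicRep (scaledGam 1 ε A B) h)) := by
  refine (sub_mem_oneCoboundaries_iff_exists 1 ε A B h hf hg).2
    ⟨fun k => if k.1 = 1 then (1 - algebraMap R F ε)⁻¹ * (X k.2 - Y k.2) else
      if k.1 = 2 then X k.2 - Y k.2 else 0, ?_⟩
  set w : Fin 5 × Fin m → F := fun k =>
    if k.1 = 1 then (1 - algebraMap R F ε)⁻¹ * (X k.2 - Y k.2) else
      if k.1 = 2 then X k.2 - Y k.2 else 0
  have ht := one_sub_algebraMap_ne_zero (F := F) hε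
  rintro ⟨i, j⟩
  rcases lt_or_ge i 2 with hi | hi
  · have hz : ((scaledGam 1 ε A B).map (algebraMap R F)).mulVec w (i, j) - w (i, j) -
        (if i = 0 then X j - Y j else 0) = 0 := by
      obtain rfl | rfl : i = 0 ∨ i = 1 := by omega
      · rw [scaledGam_mulVec_zero]; simp [w]
      · rw [scaledGam_mulVec_one]
        simp only [w, map_one]
        simp
        field_simp
        ring
    rw [hz]
    exact zero_mem _
  · have hi0 : i ≠ 0 := by rintro rfl; exact absurd hi (by decide)
    have hi1 : i ≠ 1 := by rintro rfl; exact absurd hi (by decide)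
    rw [scaledGam_mulVec_of_two_le _ _ _ _ _ hi, if_neg hi0, sub_zero]
    by_cases hi2 : i = 2
    · subst hi2
      have : (algebraMap R F ε ^ ((2 : Fin 5) : ℕ) - 1) * w (2, j) =
          algebraMap R F (-(1 + ε)) * ((1 - algebraMap R F ε) * (X j - Y j)) := by
        simp [w]
        ring
      rw [this]
      exact mul_mem ⟨_, rfl⟩ (hXY j)
    · simp only [w, if_neg hi1, if_neg hi2, mul_zero]
      exact zero_mem _

theorem isNonsplit_of_firstBlock_single (hp : 3 < p) (hε : IsPrimitiveRoot ε p)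
    (hpu : ¬ IsUnit (p : R)) (hp0 : (p : R) ≠ 0)
    (A B : Matrix (Fin m) (Fin m) R) (h : scaledGam u ε A B ^ p = 1) (j : Fin m)
    {f : oneCocycles (hatRep F (cyclicRep (scaledGam u ε A B) h))}
    (hf : f.1 (cyclicGen p) = firstBlock R (Pi.single j (p : F)⁻¹)) : IsNonsplit f := by
  intro hcob
  have hinj := FaithfulSMul.algebraMap_injective R F
  have hg : (0 : oneCocycles (hatRep F (cyclicRep (scaledGam u ε A B) h))).1 (cyclicGen p) =
      firstBlock R (0 : Fin m → F) := by
    simp [firstBlock]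
  obtain ⟨r, hr⟩ := mul_mem_range_of_sub_mem_oneCoboundaries hp hε A B h hf hg
    (by rwa [sub_zero]) j
  have hpF : (p : F) ≠ 0 := by
    rw [← map_natCast (algebraMap R F)]
    exact (map_ne_zero_iff _ hinj).2 hp0
  have h1 : (p : R) * r = 1 - ε := hinj (by
    rw [map_mul, hr, map_natCast, map_sub, map_one]
    simp only [Pi.single_eq_same, Pi.zero_apply, sub_zero]
    field_simp)
  obtain ⟨q, hq⟩ := hε.one_sub_sq_dvd_natCast (by omega)
  have ht : 1 - ε ≠ 0 := sub_ne_zero.2 (hε.ne_one (Fact.out : p.Prime).one_lt).symm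
  refine hε.not_isUnit_one_sub hpu (IsUnit.of_mul_eq_one (q * r) (mul_left_cancel₀ ht ?_))
  calc (1 - ε) * ((1 - ε) * (q * r)) = (1 - ε) ^ 2 * q * r := by ring
    _ = (1 - ε) * 1 := by rw [← hq, h1, mul_one]

/-- The module of `Γ` carries a non-split group. -/
theorem exists_isNonsplit_scaledGam (hp : 3 < p) (hε : IsPrimitiveRoot ε p)
    (hpu : ¬ IsUnit (p : R)) (hp0 : (p : R) ≠ 0) (hm : 0 < m)
    (A B : Matrix (Fin m) (Fin m) R) (h : scaledGam u ε A B ^ p = 1) :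
    ∃ f : oneCocycles (hatRep F (cyclicRep (scaledGam u ε A B) h)), IsNonsplit f := by
  have hpF : (p : F) ≠ 0 := by
    rw [← map_natCast (algebraMap R F)]
    exact (map_ne_zero_iff _ (FaithfulSMul.algebraMap_injective R F)).2 hp0
  obtain ⟨f, hf, -⟩ := existsUnique_oneCocycle_firstBlock (F := F) u ε A B h
    (Pi.single ⟨0, hm⟩ (p : F)⁻¹) fun j => by
      rcases eq_or_ne j ⟨0, hm⟩ with rfl | hj
      · exact ⟨1, by simp [hpF]⟩
      · exact ⟨0, by simp [hj]⟩
  exact ⟨f, isNonsplit_of_firstBlock_single hp hε hpu hp0 A B h _ hf⟩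

end Coordinates

section CrysTransport

variable {R G M M' F : Type*} [CommRing R] [Group G] [AddCommGroup M] [Module R M]
  [AddCommGroup M'] [Module R M'] [Field F] [Algebra R F]
  {ρ : Representation R G M} {ρ' : Representation R G M'}

theorem Crys.mul_translation (f : oneCocycles (hatRep F ρ)) (z : Crys f) (m : M) :
    z * Crys.translation f m = Crys.translation f (ρ z.1.right m) * z := by
  refine Subtype.ext (SemidirectProduct.ext ?_ ?_)
  · apply Multiplicative.toAdd.injective
    change Multiplicative.toAdd z.1.left + scalarExt F ρ z.1.right ((1 : F) ⊗ₜ[R] m) =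
      (1 : F) ⊗ₜ[R] ρ z.1.right m + scalarExt F ρ 1 (Multiplicative.toAdd z.1.left)
    rw [map_one, Module.End.one_apply, add_comm]
    simp [scalarExt]
  · change z.1.right * 1 = 1 * z.1.right
    rw [mul_one, one_mul]

theorem Crys.exists_right_eq (f : oneCocycles (hatRep F ρ)) (g : G) :
    ∃ z : Crys f, z.1.right = g := by
  obtain ⟨x, hx⟩ := Submodule.mkQ_surjective _ (f.1 g)
  exact ⟨⟨⟨Multiplicative.ofAdd x, g⟩, hx⟩, rfl⟩

theorem Crys.translation_injective (hM : Function.Injective (TensorProduct.mk R F M 1))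
    (f : oneCocycles (hatRep F ρ)) : Function.Injective (Crys.translation f) := fun _ _ h =>
  hM (congrArg (fun z : Crys f => Multiplicative.toAdd z.1.left) h)

/-- Equivalent groups `Crys(G, M, f)` have isomorphic modules. -/
theorem CrysEquivalent.nonempty_equiv (hM : Function.Injective (TensorProduct.mk R F M' 1))
    {f : oneCocycles (hatRep F ρ)} {f' : oneCocycles (hatRep F ρ')} (h : CrysEquivalent f f') :
    Nonempty (ρ.Equiv ρ') := by
  obtain ⟨Φ, hΦ, φ, hφ⟩ := h
  refine ⟨Representation.Equiv.mk φ fun g => LinearMap.ext fun m => ?_⟩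
  obtain ⟨z, rfl⟩ := Crys.exists_right_eq f g
  refine Crys.translation_injective hM f' (mul_right_cancel (b := Φ z) ?_)
  change Crys.translation f' (φ (ρ z.1.right m)) * Φ z =
    Crys.translation f' (ρ' z.1.right (φ m)) * Φ z
  rw [← hφ, ← map_mul, ← Crys.mul_translation, map_mul, hφ, Crys.mul_translation, hΦ]

/-- The isomorphism of the vector spaces `F M` that is induced by an isomorphism of modules. -/
def scalarExtEquiv (F : Type*) [Field F] [Algebra R F] (φ : ρ.Equiv ρ') :
    F ⊗[R] M ≃ₗ[R] F ⊗[R] M' :=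
  LinearEquiv.lTensor F φ.toLinearEquiv

theorem scalarExtEquiv_apply_scalarExt (φ : ρ.Equiv ρ') (g : G) (z : F ⊗[R] M) :
    scalarExtEquiv F φ (scalarExt F ρ g z) = scalarExt F ρ' g (scalarExtEquiv F φ z) := by
  induction z with
  | zero => simp
  | add x y hx hy => simp only [map_add, hx, hy]
  | tmul x m =>
    have h : φ.toLinearEquiv (ρ g m) = ρ' g (φ.toLinearEquiv m) :=
      congrArg (fun l : M →ₗ[R] M' => l m) (φ.isIntertwining' g)
    simp only [scalarExtEquiv, scalarExt, Representation.tprod_apply, TensorProduct.map_tmul,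
      LinearEquiv.lTensor_tmul, h]

theorem map_scalarExtEquiv_lattice (φ : ρ.Equiv ρ') :
    (lattice R M F).map (scalarExtEquiv F φ : F ⊗[R] M →ₗ[R] F ⊗[R] M') = lattice R M' F := by
  ext z
  constructor
  · rintro ⟨_, ⟨m, rfl⟩, rfl⟩
    exact ⟨φ.toLinearEquiv m, by simp [scalarExtEquiv]⟩
  · rintro ⟨m, rfl⟩
    refine ⟨_, ⟨φ.toLinearEquiv.symm m, rfl⟩, ?_⟩
    change (1 : F) ⊗ₜ[R] φ.toLinearEquiv (φ.toLinearEquiv.symm m) = (1 : F) ⊗ₜ[R] m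
    rw [LinearEquiv.apply_symm_apply]

/-- The isomorphism of the modules `F M / M` that is induced by an isomorphism of modules. -/
def hatEquiv (F : Type*) [Field F] [Algebra R F] (φ : ρ.Equiv ρ') :
    ((F ⊗[R] M) ⧸ lattice R M F) ≃ₗ[R] ((F ⊗[R] M') ⧸ lattice R M' F) :=
  Submodule.Quotient.equiv _ _ (scalarExtEquiv F φ) (map_scalarExtEquiv_lattice φ)

theorem hatEquiv_mkQ (φ : ρ.Equiv ρ') (z : F ⊗[R] M) :
    hatEquiv F φ ((lattice R M F).mkQ z) = (lattice R M' F).mkQ (scalarExtEquiv F φ z) :=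
  rfl

theorem hatEquiv_apply_hatRep (φ : ρ.Equiv ρ') (g : G) (v : (F ⊗[R] M) ⧸ lattice R M F) :
    hatEquiv F φ (hatRep F ρ g v) = hatRep F ρ' g (hatEquiv F φ v) := by
  obtain ⟨z, rfl⟩ := Submodule.mkQ_surjective _ v
  change hatEquiv F φ ((lattice R M F).mkQ (scalarExt F ρ g z)) =
    (lattice R M' F).mkQ (scalarExt F ρ' g (scalarExtEquiv F φ z))
  rw [hatEquiv_mkQ, scalarExtEquiv_apply_scalarExt]

/-- The transport of a cocycle along an isomorphism of modules. -/
def oneCocycles.transport (φ : ρ.Equiv ρ') (f : oneCocycles (hatRep F ρ)) :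
    oneCocycles (hatRep F ρ') :=
  ⟨fun g => hatEquiv F φ (f.1 g), fun x y => by
    simp only [f.2 x y, map_add, hatEquiv_apply_hatRep]⟩

theorem crysEquivalent_transport (φ : ρ.Equiv ρ') (f : oneCocycles (hatRep F ρ)) :
    CrysEquivalent f (oneCocycles.transport φ f) := by
  let E := scalarExtEquiv F φ
  have hmem : ∀ z : F ⊗[R] M, ∀ g, (lattice R M F).mkQ z = f.1 g ↔
      (lattice R M' F).mkQ (E z) = (oneCocycles.transport φ f).1 g := fun z g =>
    ((hatEquiv F φ).injective.eq_iff (a := (lattice R M F).mkQ z) (b := f.1 g)).symm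
  refine ⟨
    { toFun := fun z => ⟨⟨Multiplicative.ofAdd (E (Multiplicative.toAdd z.1.left)), z.1.right⟩,
        (hmem _ _).1 z.2⟩
      invFun := fun z => ⟨⟨Multiplicative.ofAdd (E.symm (Multiplicative.toAdd z.1.left)), z.1.right⟩,
        (hmem _ _).2 (by
          change (lattice R M' F).mkQ (E (E.symm (Multiplicative.toAdd z.1.left))) = _
          rw [E.apply_symm_apply]
          exact z.2)⟩
      left_inv := fun z => Subtype.ext (SemidirectProduct.ext
        (congrArg Multiplicative.ofAdd (E.symm_apply_apply _)) rfl)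
      right_inv := fun z => Subtype.ext (SemidirectProduct.ext
        (congrArg Multiplicative.ofAdd (E.apply_symm_apply _)) rfl)
      map_mul' := fun z w => Subtype.ext (SemidirectProduct.ext ?_ rfl) },
    fun z => rfl, φ.toLinearEquiv, fun m => Subtype.ext (SemidirectProduct.ext ?_ rfl)⟩
  · apply Multiplicative.toAdd.injective
    change E (Multiplicative.toAdd z.1.left + scalarExt F ρ z.1.right (Multiplicative.toAdd w.1.left))
      = E (Multiplicative.toAdd z.1.left) +
        scalarExt F ρ' z.1.right (E (Multiplicative.toAdd w.1.left))
    rw [map_add, scalarExtEquiv_apply_scalarExt]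
  · apply Multiplicative.toAdd.injective
    change E ((1 : F) ⊗ₜ[R] m) = (1 : F) ⊗ₜ[R] φ.toLinearEquiv m
    simp [E, scalarExtEquiv]

theorem IsNonsplit.transport (φ : ρ.Equiv ρ') {f : oneCocycles (hatRep F ρ)} (hf : IsNonsplit f) :
    IsNonsplit (oneCocycles.transport φ f) := by
  rintro ⟨v, hv⟩
  obtain ⟨v, rfl⟩ := (hatEquiv F φ).surjective v
  refine hf ⟨v, fun g => (hatEquiv F φ).injective ?_⟩
  rw [map_sub, hatEquiv_apply_hatRep]
  exact hv g

end CrysTransport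

section Wildness

variable {R F : Type*} [CommRing R] [IsDomain R] [Field F] [Algebra R F] [FaithfulSMul R F]
  {p : ℕ} [Fact p.Prime] {ε u s : R}

omit [IsDomain R] in
theorem injective_mk_one_pi {κ : Type*} [Fintype κ] [DecidableEq κ] :
    Function.Injective (TensorProduct.mk R F (κ → R) 1) := by
  intro v w h
  funext k
  have h' := congrFun (congrArg (TensorProduct.piScalarRight R F F κ) h) k
  refine FaithfulSMul.algebraMap_injective R F ?_
  simpa [Algebra.smul_def] using h'

theorem CrysEquivalent.pairSimilarMod (hp : 3 < p) (hε : IsPrimitiveRoot ε p)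
    (hu : u * s = 1 - ε) {m : ℕ} {A B A₁ B₁ : Matrix (Fin m) (Fin m) R}
    {h : scaledGam u ε A B ^ p = 1} {h₁ : scaledGam u ε A₁ B₁ ^ p = 1}
    {f : oneCocycles (hatRep F (cyclicRep (scaledGam u ε A B) h))}
    {f₁ : oneCocycles (hatRep F (cyclicRep (scaledGam u ε A₁ B₁) h₁))}
    (hf : CrysEquivalent f f₁) : PairSimilarMod (Ideal.span {s}) A B A₁ B₁ :=
  (nonempty_cyclicRep_scaledGam_equiv_iff hp hε hu A B A₁ B₁ h h₁).1
    (hf.nonempty_equiv injective_mk_one_pi)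

theorem isWildCrysProblem_of_isLocalRing [IsLocalRing R] [IsPrincipalIdealRing R] (hp : 3 < p)
    (hε : IsPrimitiveRoot ε p) (hpu : ¬ IsUnit (p : R)) (hp0 : (p : R) ≠ 0) :
    IsWildCrysProblem p R F := by
  obtain ⟨s, hs⟩ := (inferInstance : (IsLocalRing.maximalIdeal R).IsPrincipal)
  have hmem : 1 - ε ∈ IsLocalRing.maximalIdeal R := hε.not_isUnit_one_sub hpu
  have hspan : IsLocalRing.maximalIdeal R = Ideal.span {s} := hs
  have hne : Ideal.span {s} ≠ ⊤ := hspan ▸ (IsLocalRing.maximalIdeal.isMaximal R).ne_top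
  have hsu : ¬ IsUnit s := by rwa [Ne, Ideal.span_singleton_eq_top] at hne
  rw [hspan, Ideal.mem_span_singleton] at hmem
  obtain ⟨u, hu⟩ := hmem
  rw [mul_comm] at hu
  refine ⟨Ideal.span {s}, hspan ▸ IsLocalRing.maximalIdeal.isMaximal R, 5,
    gamBlock u ε (FreeAlgebra.ι R 0) (FreeAlgebra.ι R 1), gamBlock_pow hp hε _ _ _, ?_⟩
  have key : ∀ (V : ∀ m, Matrix (Fin m) (Fin m) R → Matrix (Fin m) (Fin m) R →
      Matrix (Fin 5 × Fin m) (Fin 5 × Fin m) R) (h : ∀ m A B, V m A B ^ p = 1),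
      (∀ m A B, V m A B = scaledGam u ε A B) →
      (∀ (m : ℕ) (A B : Matrix (Fin m) (Fin m) R),
        PairIndecomposable (matMod (Ideal.span {s}) A) (matMod (Ideal.span {s}) B) →
        RepIndecomposable (cyclicRep (V m A B) (h m A B)) ∧
        ∃ f : oneCocycles (hatRep F (cyclicRep (V m A B) (h m A B))), IsNonsplit f) ∧
      (∀ (m : ℕ) (A B A₁ B₁ : Matrix (Fin m) (Fin m) R)
        (f : oneCocycles (hatRep F (cyclicRep (V m A B) (h m A B))))
        (f₁ : oneCocycles (hatRep F (cyclicRep (V m A₁ B₁) (h m A₁ B₁)))), CrysEquivalent f f₁ →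
        PairSimilar (matMod (Ideal.span {s}) A) (matMod (Ideal.span {s}) B)
          (matMod (Ideal.span {s}) A₁) (matMod (Ideal.span {s}) B₁)) ∧
      (∀ (m : ℕ) (A B A₁ B₁ : Matrix (Fin m) (Fin m) R),
        PairSimilar (matMod (Ideal.span {s}) A) (matMod (Ideal.span {s}) B)
          (matMod (Ideal.span {s}) A₁) (matMod (Ideal.span {s}) B₁) →
        ∀ f : oneCocycles (hatRep F (cyclicRep (V m A B) (h m A B))),
          ∃ f₁ : oneCocycles (hatRep F (cyclicRep (V m A₁ B₁) (h m A₁ B₁))),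
            CrysEquivalent f f₁) := by
    intro V h hV
    obtain rfl : V = fun m A B => scaledGam u ε A B := funext₃ hV
    refine ⟨fun m A B hAB => ⟨?_, ?_⟩, fun m A B A₁ B₁ f f₁ hf => ?_, fun m A B A₁ B₁ hAB f => ?_⟩
    · exact (repIndecomposable_cyclicRep_scaledGam_iff hp hε hu.symm hsu A B (h m A B)).2 hAB
    · refine exists_isNonsplit_scaledGam hp hε hpu hp0 (Nat.pos_of_ne_zero ?_) A B (h m A B)
      rintro rfl
      exact not_nontrivial _ hAB.1
    · exact (pairSimilar_matMod_iff hne A B A₁ B₁).2 (hf.pairSimilarMod hp hε hu.symm)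
    · obtain ⟨φ⟩ := (nonempty_cyclicRep_scaledGam_equiv_iff hp hε hu.symm A B A₁ B₁
        (h m A B) (h m A₁ B₁)).2 ((pairSimilar_matMod_iff hne A B A₁ B₁).1 hAB)
      exact ⟨_, crysEquivalent_transport φ f⟩
  exact key (fun m A B => substPair _ A B) (fun m A B => substPair_pow (gamBlock_pow hp hε _ _ _) A B)
    fun m A B => substPair_gamBlock u ε A B

end Wildness

end

theorem theorem5 (p : ℕ) [Fact p.Prime] (hp : 3 < p)
    (T : Type*) [Field T] [Algebra ℚ_[p] T] [FiniteDimensional ℚ_[p] T]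
    [Algebra ℤ_[p] T] [IsScalarTower ℤ_[p] ℚ_[p] T]
    (R : Type*) [CommRing R] [Algebra R T] [IsIntegralClosure R ℤ_[p] T]
    (F : Type*) [Field F] [Algebra R F] [FaithfulSMul R F]
    (ε : R) (hε : IsPrimitiveRoot ε p) :
    IsWildCrysProblem p R F ∧
    ∃ h : ∀ (m : ℕ) (A B : Matrix (Fin m) (Fin m) R), Gam ε A B ^ p = 1,
      (∀ (m : ℕ) (A B A₁ B₁ : Matrix (Fin m) (Fin m) R),
        Nonempty ((cyclicRep (Gam ε A B) (h m A B)).Equiv (cyclicRep (Gam ε A₁ B₁) (h m A₁ B₁))) ↔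
          PairSimilarMod (Ideal.span {1 - ε}) A B A₁ B₁) ∧
      (∀ (m : ℕ) (A B : Matrix (Fin m) (Fin m) R),
        RepIndecomposable (cyclicRep (Gam ε A B) (h m A B)) ↔
          PairIndecomposable (matMod (Ideal.span {1 - ε}) A) (matMod (Ideal.span {1 - ε}) B)) ∧
      (∀ (m : ℕ) (A B : Matrix (Fin m) (Fin m) R) (X : Fin m → F),
        (∀ j, ∃ r : R, algebraMap R F r = (p : F) * X j) →
          ∃! f : oneCocycles (hatRep F (cyclicRep (Gam ε A B) (h m A B))),
            f.1 (cyclicGen p) = firstBlock R X) ∧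
      (∀ (m : ℕ) (A B : Matrix (Fin m) (Fin m) R) (X Y : Fin m → F)
        (f g : oneCocycles (hatRep F (cyclicRep (Gam ε A B) (h m A B)))),
        f.1 (cyclicGen p) = firstBlock R X → g.1 (cyclicGen p) = firstBlock R Y →
          (f - g ∈ oneCoboundaries (hatRep F (cyclicRep (Gam ε A B) (h m A B))) ↔
            ∀ j, ∃ r : R, algebraMap R F r = (1 - algebraMap R F ε) * (X j - Y j))) ∧
      (∀ (m : ℕ) (A B : Matrix (Fin m) (Fin m) R) (j : Fin m)
        (f : oneCocycles (hatRep F (cyclicRep (Gam ε A B) (h m A B)))),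
        f.1 (cyclicGen p) = firstBlock R (Pi.single j (p : F)⁻¹) → IsNonsplit f) ∧
      (∀ (m : ℕ) (A B : Matrix (Fin m) (Fin m) R), 0 < m →
        Nontrivial (firstCohomology (hatRep F (cyclicRep (Gam ε A B) (h m A B))))) ∧
      (∀ (m : ℕ) (A B A₁ B₁ : Matrix (Fin m) (Fin m) R), 0 < m →
        ((∃ (f : oneCocycles (hatRep F (cyclicRep (Gam ε A B) (h m A B))))
            (f₁ : oneCocycles (hatRep F (cyclicRep (Gam ε A₁ B₁) (h m A₁ B₁)))),
            IsNonsplit f ∧ IsNonsplit f₁ ∧ CrysEquivalent f f₁) ↔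
          PairSimilarMod (Ideal.span {1 - ε}) A B A₁ B₁)) := by
  have : IsDomain R := IsIntegralClosure.isDomain_of_padicInt p T R
  have : IsLocalRing R := IsIntegralClosure.isLocalRing_of_padicInt p T R
  have : IsPrincipalIdealRing R := IsIntegralClosure.isPrincipalIdealRing_of_padicInt p T R
  have : CharZero R := IsIntegralClosure.charZero_of_padicInt p T R
  have hpu : ¬ IsUnit (p : R) := IsIntegralClosure.not_isUnit_natCast_of_padicInt p T R
  have hp0 : (p : R) ≠ 0 := Nat.cast_ne_zero.2 (Fact.out : p.Prime).ne_zero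
  have ht : ¬ IsUnit (1 - ε) := hε.not_isUnit_one_sub hpu
  have hu : 1 * (1 - ε) = 1 - ε := one_mul _
  have H : ∀ (m : ℕ) (A B : Matrix (Fin m) (Fin m) R), Gam ε A B ^ p = 1 := fun m A B =>
    scaledGam_one ε A B ▸ scaledGam_pow hp hε 1 A B
  refine ⟨isWildCrysProblem_of_isLocalRing hp hε hpu hp0,
    H, ?_, ?_, ?_, ?_, ?_, ?_, ?_⟩
  · intro m A B A₁ B₁
    generalize H m A B = h, H m A₁ B₁ = h₁
    revert h h₁
    rw [← scaledGam_one, ← scaledGam_one]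
    exact nonempty_cyclicRep_scaledGam_equiv_iff hp hε hu A B A₁ B₁
  · intro m A B
    generalize H m A B = h
    revert h
    rw [← scaledGam_one]
    exact repIndecomposable_cyclicRep_scaledGam_iff hp hε hu ht A B
  · intro m A B X hX
    generalize H m A B = h
    revert h
    rw [← scaledGam_one]
    exact fun h => existsUnique_oneCocycle_firstBlock 1 ε A B h X hX
  · intro m A B X Y
    generalize H m A B = h
    revert h
    rw [← scaledGam_one]
    exact fun h f g hf hg =>
      ⟨mul_mem_range_of_sub_mem_oneCoboundaries hp hε A B h hf hg,
        sub_mem_oneCoboundaries_of_mul_mem_range hε A B h hf hg⟩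
  · intro m A B j
    generalize H m A B = h
    revert h
    rw [← scaledGam_one]
    exact fun h f hf => isNonsplit_of_firstBlock_single hp hε hpu hp0 A B h j hf
  · intro m A B hm
    generalize H m A B = h
    revert h
    rw [← scaledGam_one]
    intro h
    obtain ⟨f, hf⟩ := exists_isNonsplit_scaledGam (F := F) hp hε hpu hp0 hm A B h
    exact Submodule.Quotient.nontrivial_iff.2 fun htop => hf (htop ▸ Submodule.mem_top)
  · intro m A B A₁ B₁ hm
    generalize H m A B = h, H m A₁ B₁ = h₁
    revert h h₁
    rw [← scaledGam_one, ← scaledGam_one]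
    intro h h₁
    constructor
    · rintro ⟨f, f₁, -, -, hf⟩
      exact hf.pairSimilarMod hp hε hu
    · intro hAB
      obtain ⟨φ⟩ := (nonempty_cyclicRep_scaledGam_equiv_iff hp hε hu A B A₁ B₁ h h₁).2 hAB
      obtain ⟨f, hf⟩ := exists_isNonsplit_scaledGam (F := F) hp hε hpu hp0 hm A B h
      exact ⟨f, _, hf, hf.transport φ, crysEquivalent_transport φ f⟩
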